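/- **Quantum Laplace Transform with complex coefficients.** *Conventions.* A unitary $U$ on $a+n$ qubits is an $(\alpha,a,\epsilon)$-block-encoding of an $n$-qubit operator $A$ if $\|A-\alpha(\langle 0|^{\otimes a}\otimes I)U(|0\rangle^{\otimes a}\otimes I)\|\le\epsilon$ in spectral norm. A circuit consists of layers of one- and two-qubit unitary gates (the gates of a layer acting on disjoint qubits) and of uses of one-controlled black boxes $C(U)=|0\rangle\langle 0|\otimes I+|1\rangle\langle 1|\otimes U$. Its size is the number of its one- and two-qubit gates and its depth is the number of layers of such gates; the black boxes are counted separately. For $N=2^n$ and $x,y\in\mathbb C^N$ let $\widehat{QLT}=\frac1N(e^{x_iy_j})_{i,j}$, $x_{\max}=\max_i|x_i|$, $y_{\max}=\max_j|y_j|$, and $$\hat X_k=\sum_i (x_i/x_{\max})^k|i\rangle\langle i|,\qquad \hat Y_k=\sum_j (y_j/y_{\max})^k|j\rangle\langle j|.$$ Let $R=\max_j|\Re y_j|$, $M=\max_j|\Im y_j|$, $\tilde x_i=x_iR$, $\tilde y_j=\Re(y_j)/R$, $\tilde x_i'=\mathbf i x_iM$, $\tilde y_j'=\Im(y_j)/M$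 (a quotient $0/0$ being read as $0$). Let $I_k$ be the modified Bessel function of the first kind, $T_k$ the Chebyshev polynomial, $I_{k,\max}=e^{x_{\max}y_{\max}}(x_{\max}y_{\max}/2)^k/k!$, and $$\hat I_{k,k'}=\sum_i\frac{I_k(\tilde x_i)I_{k'}(\tilde x_i')}{I_{k,\max}I_{k',\max}}|i\rangle\langle i|,\qquad \hat T_{k,k'}=\sum_j T_k(\tilde y_j)T_{k'}(\tilde y_j')|j\rangle\langle j|,$$ $$\alpha=e^{2x_{\max}y_{\max}}\bigl(2e^{x_{\max}y_{\max}/2}-1\bigr)^2 ,\qquad S=x_{\max}y_{\max}+\frac{\ln(1/\epsilon)}{\ln\bigl(e+\frac{\ln(1/\epsilon)}{x_{\max}y_{\max}}\bigr)}.$$ *Theorem.* (1) There are absolute constants $c,C>0$ and $p\in\mathbb N$ such that the following holds for all $n\ge1$, $a_{be}\ge0$, $\epsilon\in(0,1)$, all $x,y\in\mathbb C^N$ with $x_{\max},y_{\max}>0$, and all integers $K\ge1$ with $K\ge cS$ (so that one may take $K=\max(1,\lceil cS\rceil)$, which is of order $S$ up to rounding). * *Taylor expansion.* There is a circuit on $n$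 qubits and $2n+2a_{be}+\lceil\log_2(K+1)\rceil$ ancilla qubits, with at most $CK$ one-controlled black boxes $C(U_{X,k})$, $C(U_{Y,k})$, $0\le k\le K$, of size at most $C\,nK(1+\ln K)^p$ and depth at most $C(1+\ln n)K(1+\ln K)^p$, which is an $(e^{x_{\max}y_{\max}},\,2n+2a_{be}+\lceil\log_2(K+1)\rceil,\,\epsilon)$-block-encoding of $\widehat{QLT}$ whenever $U_{X,k}$ and $U_{Y,k}$ are $(1,a_{be},\epsilon/(6e^{x_{\max}y_{\max}}))$-block-encodings of $\hat X_k$ and $\hat Y_k$ for all $k$. * *Chebyshev expansion.* There is a circuit on $n$ qubits and $2n+2a_{be}+\lceil2\log_2(K+1)\rceil$ ancilla qubits, with at most $CK^2$ one-controlled black boxes $C(U_{I,k,k'})$, $C(U_{T,k,k'})$, $0\le k,k'\le K$, of size at most $C\,nK^2(1+\ln K)^p$ and depth at most $C(1+\ln n)K^2(1+\ln K)^p$, which is an $(\alpha,\,2n+2a_{be}+\lceil2\log_2(K+1)\rceil,\,\epsilon)$-block-encoding of $\widehat{QLT}$ whenever $U_{I,k,k'}$ and $U_{T,k,k'}$ are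 $(1,a_{be},\epsilon/(6\alpha))$-block-encodings of $\hat I_{k,k'}$ and $\hat T_{k,k'}$ for all $k,k'$. (2) For all integers $n,K\ge0$, all $x,y\in\mathbb C^N$ with $K+1\ge x_{\max}y_{\max}$, and all $i,j$, with $\delta_0=1$ and $\delta_k=0$ for $k\ge1$, $$\Bigl|e^{x_iy_j}-\sum_{k=0}^K\sum_{k'=0}^K(2-\delta_k)(2-\delta_{k'})I_k(\tilde x_i)I_{k'}(\tilde x_i')T_k(\tilde y_j)T_{k'}(\tilde y_j')\Bigr|\le\frac{8e^{\frac52x_{\max}y_{\max}}}{(K+1)!}\Bigl(\frac{x_{\max}y_{\max}}2\Bigr)^{K+1}.$$ -/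

import Mathlib

open scoped Matrix Matrix.Norms.L2Operator

/-! ### Registers of qubits and block-encodings -/

/-- Labels of the computational basis of a register of qubits whose wires are indexed by `W`. -/
abbrev Bits (W : Type) : Type := W → Fin 2

/-- Operators on a register of qubits with wires `W`, written in the computational basis. -/
abbrev Op (W : Type) : Type := Matrix (Bits W) (Bits W) ℂ

/-- The corner `(⟨0|^{⊗a} ⊗ I) U (|0⟩^{⊗a} ⊗ I)` of an operator on `a` ancilla qubits
and a further register `W`. -/
def zeroBlock {W : Type} {a : ℕ} (U : Op (Fin a ⊕ W)) : Op W :=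
  Matrix.of fun s t => U (Sum.elim (fun _ => 0) s) (Sum.elim (fun _ => 0) t)

/-- The unitary `U` is an `(α, a, ε)`-block-encoding of the `n`-qubit operator `A`;
the norm is the spectral norm. -/
def IsBlockEncoding {n a : ℕ} (α ε : ℝ) (U : Op (Fin a ⊕ Fin n)) (A : Op (Fin n)) : Prop :=
  U ∈ Matrix.unitaryGroup (Bits (Fin a ⊕ Fin n)) ℂ ∧ ‖A - (α : ℂ) • zeroBlock U‖ ≤ ε

/-! ### Quantum circuits with controlled black boxes -/

/-- The operator `G` applied to the wires `f v` of a register `W`, tensored with the identity on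
all the other wires. -/
noncomputable def applyOn {V W : Type} [Fintype V] [Fintype W] [DecidableEq W]
    (f : V ↪ W) (G : Op V) : Op W :=
  Matrix.of fun s t =>
    if ∀ w, (∀ v, f v ≠ w) → s w = t w then G (s ∘ f) (t ∘ f) else 0

/-- The one-controlled operator `C(U) = |0⟩⟨0| ⊗ I + |1⟩⟨1| ⊗ U`; the control qubit is the wire
`Sum.inl ()`. -/
noncomputable def controlled {V : Type} [Fintype V] (U : Op V) : Op (Unit ⊕ V) :=
  Matrix.of fun s t =>
    if s (Sum.inl ()) ≠ t (Sum.inl ()) then 0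
    else if s (Sum.inl ()) = 0 then (1 : Op V) (s ∘ Sum.inr) (t ∘ Sum.inr)
    else U (s ∘ Sum.inr) (t ∘ Sum.inr)

/-- A primitive quantum gate: an arbitrary one- or two-qubit unitary placed on distinct wires. -/
structure Gate (W : Type) where
  arity : ℕ
  one_le_arity : 1 ≤ arity
  arity_le_two : arity ≤ 2
  wires : Fin arity ↪ W
  op : Matrix.unitaryGroup (Bits (Fin arity)) ℂ

/-- Two gates act on disjoint sets of wires. -/
def Gate.DisjointWires {W : Type} (g h : Gate W) : Prop :=
  ∀ i j, g.wires i ≠ h.wires j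

/-- A step of a circuit on the wires `W` is either one layer of primitive gates acting on pairwise
disjoint wires, or one use of the controlled version `C(U_o)` of the black box with label `o`,
where each `U_o` is an operator on a register with wires `V`; `place` says which wire of the
circuit is the control and which ones carry `U_o`. -/
inductive Step (W V O : Type) : Type
  | layer (gates : List (Gate W)) (disjoint : gates.Pairwise Gate.DisjointWires) : Step W V O
  | query (o : O) (place : (Unit ⊕ V) ↪ W) : Step W V O

/-- A circuit: the list of its steps, the first one being applied first. -/
abbrev Circuit (W V O : Type) : Type := List (Step W V O)

section Circuit

variable {W V O : Type}

/-- The operator performed by one step when the black boxes are `U`. -/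
noncomputable def Step.eval [Fintype W] [DecidableEq W] [Fintype V] (U : O → Op V) :
    Step W V O → Op W
  | .layer gates _ => (gates.map fun g => applyOn g.wires (g.op : Op (Fin g.arity))).prod
  | .query o place => applyOn place (controlled (U o))

/-- The operator performed by a circuit when the black boxes are `U`. -/
noncomputable def Circuit.eval [Fintype W] [DecidableEq W] [Fintype V] (U : O → Op V) :
    Circuit W V O → Op W
  | [] => 1
  | s :: c => Circuit.eval U c * s.eval U

/-- The number of primitive gates of a step. -/
def Step.size : Step W V O → ℕ
  | .layer gates _ => gates.length
  | .query _ _ => 0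

/-- A layer of primitive gates has depth one; black boxes are counted separately. -/
def Step.depth : Step W V O → ℕ
  | .layer _ _ => 1
  | .query _ _ => 0

/-- The number of controlled black boxes of a step. -/
def Step.queries : Step W V O → ℕ
  | .layer _ _ => 0
  | .query _ _ => 1

/-- The number of primitive gates of a circuit, its controlled black boxes being left out. -/
def Circuit.size (c : Circuit W V O) : ℕ := (c.map Step.size).sum

/-- The number of layers of primitive gates of a circuit. -/
def Circuit.depth (c : Circuit W V O) : ℕ := (c.map Step.depth).sum

/-- The number of controlled black boxes used by a circuit. -/
def Circuit.queries (c : Circuit W V O) : ℕ := (c.map Step.queries).sum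

end Circuit

/-! ### The quantum Laplace transform -/

/-- The number in `{0, …, 2 ^ n - 1}` whose binary digits label a basis state of `n` qubits. -/
def basisIndex {n : ℕ} (s : Bits (Fin n)) : Fin (2 ^ n) := finFunctionFinEquiv s

/-- The diagonal `n`-qubit operator with diagonal entries `d`. -/
def diagOp {n : ℕ} (d : Fin (2 ^ n) → ℂ) : Op (Fin n) :=
  Matrix.diagonal fun s => d (basisIndex s)

/-- The quantum Laplace transform, with entries `e ^ (x i * y j) / N`, where `N = 2 ^ n`. -/
noncomputable def QLT {n : ℕ} (x y : Fin (2 ^ n) → ℂ) : Op (Fin n) :=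
  Matrix.of fun s t => Complex.exp (x (basisIndex s) * y (basisIndex t)) / 2 ^ n

/-- The maximum of the moduli of the coefficients. -/
noncomputable def maxAbs {N : ℕ} (x : Fin N → ℂ) : ℝ := ⨆ i, ‖x i‖

/-- The maximum of the absolute values of the real parts. -/
noncomputable def maxRe {N : ℕ} (y : Fin N → ℂ) : ℝ := ⨆ j, |(y j).re|

/-- The maximum of the absolute values of the imaginary parts. -/
noncomputable def maxIm {N : ℕ} (y : Fin N → ℂ) : ℝ := ⨆ j, |(y j).im|

/-- The modified Bessel function of the first kind of order `k`. -/
noncomputable def besselI (k : ℕ) (z : ℂ) : ℂ :=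
  ∑' m : ℕ, (z / 2) ^ (2 * m + k) / ((m.factorial : ℂ) * ((m + k).factorial : ℂ))

/-- The Chebyshev polynomial `T_k` at a real point. -/
noncomputable def chebT (k : ℕ) (t : ℝ) : ℝ := (Polynomial.Chebyshev.T ℝ (k : ℤ)).eval t

section Coefficients

variable {N : ℕ} (x y : Fin N → ℂ)

/-- `x̃_i = x_i max_j |Re y_j|`. -/
noncomputable def xRe (i : Fin N) : ℂ := x i * (maxRe y : ℂ)

/-- `ỹ_j = Re y_j / max_j |Re y_j|` (equal to `0` if all the real parts vanish). -/
noncomputable def yRe (j : Fin N) : ℝ := (y j).re / maxRe y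

/-- `x̃'_i = 𝐢 x_i max_j |Im y_j|`. -/
noncomputable def xIm (i : Fin N) : ℂ := Complex.I * x i * (maxIm y : ℂ)

/-- `ỹ'_j = Im y_j / max_j |Im y_j|` (equal to `0` if all the imaginary parts vanish). -/
noncomputable def yIm (j : Fin N) : ℝ := (y j).im / maxIm y

/-- The normalisation `I_{k,max} = e ^ (x_max y_max) (x_max y_max / 2) ^ k / k!`, used for both the
real and the imaginary part. -/
noncomputable def besselMax (k : ℕ) : ℝ :=
  Real.exp (maxAbs x * maxAbs y) * (maxAbs x * maxAbs y / 2) ^ k / (k.factorial : ℝ)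

/-- The factor `2 - δ_k` of the Chebyshev series. -/
def chebWeight (k : ℕ) : ℂ := if k = 0 then 1 else 2

/-- The double Chebyshev series of `e ^ (x_i y_j)` truncated at order `K`. -/
noncomputable def doubleChebSum (K : ℕ) (i j : Fin N) : ℂ :=
  ∑ k ∈ Finset.range (K + 1), ∑ k' ∈ Finset.range (K + 1),
    chebWeight k * chebWeight k' * besselI k (xRe x y i) * besselI k' (xIm x y i)
      * (chebT k (yRe y j) : ℂ) * (chebT k' (yIm y j) : ℂ)

/-- The normalisation `α = e ^ (2 x_max y_max) (2 e ^ (x_max y_max / 2) - 1) ^ 2`. -/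
noncomputable def chebAlpha : ℝ :=
  Real.exp (2 * (maxAbs x * maxAbs y)) * (2 * Real.exp (maxAbs x * maxAbs y / 2) - 1) ^ 2

end Coefficients

section Diagonal

variable {n : ℕ}

/-- `X̂_k = ∑_i (x_i / x_max) ^ k |i⟩⟨i|`; applied to `y`, this is `Ŷ_k`. -/
noncomputable def powOp (x : Fin (2 ^ n) → ℂ) (k : ℕ) : Op (Fin n) :=
  diagOp fun i => (x i / (maxAbs x : ℂ)) ^ k

/-- `Î_{k,k'} = ∑_i I_k(x̃_i) I_k'(x̃'_i) / (I_{k,max} I_{k',max}) |i⟩⟨i|`. -/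
noncomputable def besselOp (x y : Fin (2 ^ n) → ℂ) (k k' : ℕ) : Op (Fin n) :=
  diagOp fun i => besselI k (xRe x y i) * besselI k' (xIm x y i)
    / ((besselMax x y k : ℂ) * (besselMax x y k' : ℂ))

/-- `T̂_{k,k'} = ∑_j T_k(ỹ_j) T_k'(ỹ'_j) |j⟩⟨j|`. -/
noncomputable def chebOp (y : Fin (2 ^ n) → ℂ) (k k' : ℕ) : Op (Fin n) :=
  diagOp fun j => (chebT k (yRe y j) : ℂ) * (chebT k' (yIm y j) : ℂ)

end Diagonal

/-- The scale `z + ln(1/ε) / ln(e + ln(1/ε) / z)` of the truncation order, with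
`z = x_max y_max`. -/
noncomputable def truncationScale (z ε : ℝ) : ℝ :=
  z + Real.log (1 / ε) / Real.log (Real.exp 1 + Real.log (1 / ε) / z)

/-! All entries of the projection J onto the uniform superposition equal 1/N, so diag(d) J diag(d')
has entries d_i d'_j / N. A separable expansion e^{x_i y_j} ≈ Σ_k w_k d_k(i) d'_k(j) with w_k ≥ 0
therefore approximates the transform by Σ_k w_k D_k J D'_k, and a uniform kernel error η costs at
most η in spectral norm (`norm_le_of_entries`). `exists_blockEncoding_QLT` spends ε/2 on this error
and ε/2 on the imperfect block-encodings of D_k and D'_k.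

The combination is realised by one circuit (`exists_linearCombination_circuit`). An index register
is prepared with amplitudes proportional to √w_k (`exists_statePreparation`); D'_k, then J, then D_k
are applied for the index k; the preparation is undone. A rotation of a flag qubit lowers the scale
from Σ w_k to the prescribed α. J needs one layer of gates `SWAP (H ⊗ H)` pairing each data qubit
with a fresh ancilla, so n does not multiply the depth. Selecting k means flipping the flag when the
index register reads k, using the black box controlled by the flag, and flipping back. The multiply
controlled flip needs no further ancilla: a commutator of two controlled gates is controlled by both
sets of controls, and in SU(2) the flip is a commutator of two of its own conjugates
(`exists_commutator_eq_flipY`). An L-qubit index thus costs O(L²) gates per term, whence the factor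
(1 + ln K)².

With z = x_max y_max, the Taylor series gives weights z^k/k!, of sum at most e^z. The Chebyshev
version writes x_i y_j = x̃_i ỹ_j + x̃'_i ỹ'_j and multiplies two Jacobi–Anger expansions e^{wt} = Σ
(2 - δ_k) I_k(w) T_k(t), whose tails and partial sums are bounded in `jacobiAnger_truncation`. Both
remainders are controlled by 16 e^{3z} z^{K+1}/(K+1)!, which `truncation_error_le` brings below ε by
means of z^m/m! ≤ (ze/m)^m. -/

set_option linter.unusedSectionVars false

/-! ### The algebra of local operators -/

section ApplyOn

variable {V V' W : Type} [Fintype V] [Fintype W] [DecidableEq W]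

theorem applyOn_apply (f : V ↪ W) (G : Op V) (s t : Bits W) :
    applyOn f G s t = if ∀ w, (∀ v, f v ≠ w) → s w = t w then G (s ∘ f) (t ∘ f) else 0 := rfl

theorem applyOn_support {f : V ↪ W} {G : Op V} {s t : Bits W} (h : applyOn f G s t ≠ 0) {w : W}
    (hw : ∀ v, f v ≠ w) : s w = t w := by
  rw [applyOn_apply] at h
  by_contra hne
  exact h (if_neg fun h' => hne (h' w hw))

theorem extend_comp_emb (f : V ↪ W) (u : Bits V) (s : Bits W) : Function.extend f u s ∘ f = u :=
  funext fun v => f.injective.extend_apply u s v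

theorem extend_off (f : V ↪ W) (u : Bits V) (s : Bits W) {w : W} (hw : ∀ v, f v ≠ w) :
    Function.extend f u s w = s w :=
  Function.extend_apply' _ _ _ fun ⟨v, hv⟩ => hw v hv

theorem extend_self_of_agree (f : V ↪ W) {r s : Bits W}
    (h : ∀ w, (∀ v, f v ≠ w) → s w = r w) : Function.extend f (r ∘ f) s = r := by
  funext w
  by_cases hw : ∃ v, f v = w
  · obtain ⟨v, rfl⟩ := hw
    exact f.injective.extend_apply _ _ v
  · have hw' : ∀ v, f v ≠ w := fun v hv => hw ⟨v, hv⟩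
    rw [extend_off f _ _ hw', h w hw']

variable [DecidableEq V]

/-- Row `s` is supported on the columns that differ from `s` only on the wires of `f`, and these are
parametrised by `Function.extend f u s`. -/
theorem sum_applyOn_mul (f : V ↪ W) (G : Op V) (s : Bits W) (h : Bits W → ℂ) :
    ∑ r, applyOn f G s r * h r = ∑ u, G (s ∘ f) u * h (Function.extend f u s) := by
  symm
  refine Finset.sum_of_injOn (fun u => Function.extend f u s) ?_ (by simp) ?_ ?_
  · intro u _ u' _ huu
    have := congrArg (fun r => r ∘ f) huu
    simpa [extend_comp_emb] using this
  · intro r _ hr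
    rw [applyOn_apply, if_neg, zero_mul]
    intro hagree
    exact hr ⟨r ∘ f, by simp, extend_self_of_agree f hagree⟩
  · intro u _
    rw [applyOn_apply, if_pos fun w hw => (extend_off f u s hw).symm, extend_comp_emb]

theorem applyOn_mul_apply {X : Type*} (f : V ↪ W) (G : Op V) (B : Matrix (Bits W) X ℂ)
    (s : Bits W) (x : X) :
    (applyOn f G * B) s x = ∑ u, G (s ∘ f) u * B (Function.extend f u s) x := by
  rw [Matrix.mul_apply, sum_applyOn_mul f G s fun r => B r x]

theorem applyOn_mul (f : V ↪ W) (G H : Op V) :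
    applyOn f (G * H) = applyOn f G * applyOn f H := by
  ext s t
  rw [applyOn_mul_apply, applyOn_apply]
  by_cases hst : ∀ w, (∀ v, f v ≠ w) → s w = t w
  · rw [if_pos hst, Matrix.mul_apply]
    refine Finset.sum_congr rfl fun u _ => ?_
    rw [applyOn_apply, if_pos, extend_comp_emb]
    intro w hw
    rw [extend_off f u s hw, hst w hw]
  · rw [if_neg hst]
    refine (Finset.sum_eq_zero fun u _ => ?_).symm
    rw [applyOn_apply, if_neg, mul_zero]
    intro h
    exact hst fun w hw => by rw [← h w hw, extend_off f u s hw]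

theorem applyOn_one (f : V ↪ W) : applyOn f (1 : Op V) = 1 := by
  ext s t
  rw [applyOn_apply, Matrix.one_apply, Matrix.one_apply]
  by_cases hst : s = t
  · subst hst; simp
  · rw [if_neg hst]
    split_ifs with h1 h2
    · exfalso
      refine hst ?_
      rw [← extend_self_of_agree f h1, ← h2]
      exact (extend_self_of_agree f fun _ _ => rfl).symm
    · rfl
    · rfl

theorem applyOn_star (f : V ↪ W) (G : Op V) : applyOn f (star G) = star (applyOn f G) := by
  ext s t
  rw [Matrix.star_apply, applyOn_apply, applyOn_apply]
  by_cases h : ∀ w, (∀ v, f v ≠ w) → s w = t w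
  · rw [if_pos h, if_pos fun w hw => (h w hw).symm, Matrix.star_apply]
  · rw [if_neg h, if_neg fun h' => h fun w hw => (h' w hw).symm, star_zero]

theorem applyOn_mem_unitaryGroup (f : V ↪ W) {G : Op V}
    (hG : G ∈ Matrix.unitaryGroup (Bits V) ℂ) :
    applyOn f G ∈ Matrix.unitaryGroup (Bits W) ℂ := by
  rw [Matrix.mem_unitaryGroup_iff] at hG ⊢
  rw [← applyOn_star, ← applyOn_mul, hG, applyOn_one]

theorem applyOn_applyOn [Fintype V'] (g : V' ↪ V) (f : V ↪ W) (G : Op V') :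
    applyOn f (applyOn g G) = applyOn (g.trans f) G := by
  ext s t
  simp only [applyOn_apply]
  by_cases h : ∀ w, (∀ v, (g.trans f) v ≠ w) → s w = t w
  · rw [if_pos h, if_pos, if_pos]
    · rfl
    · intro v hv
      exact h _ fun v' hv' => hv v' (f.injective hv')
    · intro w hw
      exact h _ fun v' hv' => hw _ hv'
  · rw [if_neg h]
    split_ifs with h1 h2
    · exfalso
      refine h fun w hw => ?_
      by_cases hwf : ∃ v, f v = w
      · obtain ⟨v, rfl⟩ := hwf
        exact h2 v fun v' hv' => hw v' (congrArg f hv')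
      · exact h1 w fun v hv => hwf ⟨v, hv⟩
    · rfl
    · rfl

variable [Fintype V'] [DecidableEq V']

/-- Only one intermediate state contributes: the one equal to `t` on the wires of `f` and to `s`
elsewhere. The resulting formula is symmetric in the two factors, which is what `applyOn_commute`
uses. -/
theorem applyOn_mul_applyOn_of_disjoint (f : V ↪ W) (g : V' ↪ W) (hfg : ∀ v v', f v ≠ g v')
    (G : Op V) (H : Op V') (s t : Bits W) :
    (applyOn f G * applyOn g H) s t =
      if ∀ w, (∀ v, f v ≠ w) → (∀ v, g v ≠ w) → s w = t w then
        G (s ∘ f) (t ∘ f) * H (s ∘ g) (t ∘ g) else 0 := by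
  rw [applyOn_mul_apply, Finset.sum_eq_single (t ∘ f)]
  · have hg : Function.extend f (t ∘ f) s ∘ g = s ∘ g :=
      funext fun v' => extend_off f _ s fun v => hfg v v'
    rw [applyOn_apply, hg]
    by_cases h : ∀ w, (∀ v, f v ≠ w) → (∀ v, g v ≠ w) → s w = t w
    · rw [if_pos h, if_pos]
      intro w hw
      by_cases hwf : ∃ v, f v = w
      · obtain ⟨v, rfl⟩ := hwf
        exact f.injective.extend_apply _ _ v
      · have hwf' : ∀ v, f v ≠ w := fun v hv => hwf ⟨v, hv⟩
        rw [extend_off f _ _ hwf', h w hwf' hw]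
    · rw [if_neg h, if_neg, mul_zero]
      intro h'
      exact h fun w hw hw' => by rw [← h' w hw', extend_off f _ _ hw]
  · intro u _ hu
    rw [applyOn_apply, if_neg, mul_zero]
    intro h
    refine hu (funext fun v => ?_)
    rw [Function.comp_apply, ← h (f v) fun v' hv' => hfg v v' hv'.symm,
      f.injective.extend_apply]
  · simp

theorem applyOn_commute (f : V ↪ W) (g : V' ↪ W) (hfg : ∀ v v', f v ≠ g v')
    (G : Op V) (H : Op V') : Commute (applyOn f G) (applyOn g H) := by
  ext s t
  rw [applyOn_mul_applyOn_of_disjoint f g hfg,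
    applyOn_mul_applyOn_of_disjoint g f fun v v' => (hfg v' v).symm]
  refine if_congr ?_ (mul_comm _ _) rfl
  exact ⟨fun h w h1 h2 => h w h2 h1, fun h w h1 h2 => h w h2 h1⟩

end ApplyOn

/-! ### Multiplexed one-qubit operators -/

section Multiplexed

variable {V W : Type} [Fintype V] [Fintype W] [DecidableEq W]

/-- The operator that applies to the wire `t` a `2 × 2` matrix selected by the other bits. -/
def multiplexed (t : W) (F : Bits W → Matrix (Fin 2) (Fin 2) ℂ) : Op W :=
  Matrix.of fun s s' => if ∀ w, w ≠ t → s w = s' w then F s' (s t) (s' t) else 0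

/-- The function `F` does not read the bit `t`. -/
def IgnoresBit {X : Type*} (t : W) (F : Bits W → X) : Prop :=
  ∀ s s' : Bits W, (∀ w, w ≠ t → s w = s' w) → F s = F s'

theorem multiplexed_apply (t : W) (F : Bits W → Matrix (Fin 2) (Fin 2) ℂ) (s s' : Bits W) :
    multiplexed t F s s' = if ∀ w, w ≠ t → s w = s' w then F s' (s t) (s' t) else 0 := rfl

theorem multiplexed_support {t : W} {F : Bits W → Matrix (Fin 2) (Fin 2) ℂ} {s s' : Bits W}
    (h : multiplexed t F s s' ≠ 0) {w : W} (hw : w ≠ t) : s w = s' w := by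
  rw [multiplexed_apply] at h
  by_contra hne
  exact h (if_neg fun h' => hne (h' w hw))

/-- The definition evaluates `F` at the column; since `F` does not read the bit `t`, it may be
evaluated at the row instead. -/
theorem multiplexed_mul_apply {X : Type*} (t : W) (F : Bits W → Matrix (Fin 2) (Fin 2) ℂ)
    (hF : IgnoresBit t F) (B : Matrix (Bits W) X ℂ) (s : Bits W) (x : X) :
    (multiplexed t F * B) s x = ∑ b, F s (s t) b * B (Function.update s t b) x := by
  rw [Matrix.mul_apply]
  symm
  refine Finset.sum_of_injOn (fun b => Function.update s t b) ?_ (by simp) ?_ ?_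
  · intro b _ b' _ h
    have := congrFun h t
    simpa using this
  · intro r _ hr
    rw [multiplexed_apply, if_neg, zero_mul]
    intro h
    refine hr ⟨r t, by simp, ?_⟩
    funext w
    by_cases hw : w = t
    · subst hw; simp
    · simp [hw, h w hw]
  · intro b _
    have h : ∀ w, w ≠ t → s w = Function.update s t b w := fun w hw => by simp [hw]
    rw [multiplexed_apply, if_pos h, hF _ _ h]
    simp

theorem multiplexed_mul (t : W) (F G : Bits W → Matrix (Fin 2) (Fin 2) ℂ)
    (hF : IgnoresBit t F) :
    multiplexed t F * multiplexed t G = multiplexed t fun s => F s * G s := by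
  ext s s'
  rw [multiplexed_mul_apply t F hF, multiplexed_apply]
  by_cases h : ∀ w, w ≠ t → s w = s' w
  · rw [if_pos h, Matrix.mul_apply, hF s s' h]
    refine Finset.sum_congr rfl fun b _ => ?_
    rw [multiplexed_apply, if_pos fun w hw => by simp [hw, h w hw]]
    simp
  · rw [if_neg h]
    refine Finset.sum_eq_zero fun b _ => ?_
    rw [multiplexed_apply, if_neg, mul_zero]
    intro h'
    exact h fun w hw => by simpa [hw] using h' w hw

theorem multiplexed_one (t : W) : multiplexed t (fun _ => 1) = (1 : Op W) := by
  ext s s'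
  rw [multiplexed_apply, Matrix.one_apply, Matrix.one_apply]
  by_cases hst : s = s'
  · subst hst; simp
  · rw [if_neg hst]
    split_ifs with h1 h2
    · exfalso
      refine hst (funext fun w => ?_)
      by_cases hw : w = t
      · rw [hw, h2]
      · exact h1 w hw
    · rfl
    · rfl

theorem multiplexed_star (t : W) (F : Bits W → Matrix (Fin 2) (Fin 2) ℂ) (hF : IgnoresBit t F) :
    star (multiplexed t F) = multiplexed t fun s => star (F s) := by
  ext s s'
  rw [Matrix.star_apply, multiplexed_apply, multiplexed_apply]
  by_cases h : ∀ w, w ≠ t → s w = s' w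
  · rw [if_pos h, if_pos fun w hw => (h w hw).symm, Matrix.star_apply, hF s s' h]
  · rw [if_neg h, if_neg fun h' => h fun w hw => (h' w hw).symm, star_zero]

theorem multiplexed_mem_unitaryGroup (t : W)
    (F : Bits W → Matrix.unitaryGroup (Fin 2) ℂ) (hF : IgnoresBit t F) :
    multiplexed t (fun s => (F s : Matrix (Fin 2) (Fin 2) ℂ)) ∈
      Matrix.unitaryGroup (Bits W) ℂ := by
  have hF' : IgnoresBit t fun s => (F s : Matrix (Fin 2) (Fin 2) ℂ) :=
    fun s s' h => by simp only [hF s s' h]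
  rw [Matrix.mem_unitaryGroup_iff, multiplexed_star t _ hF', multiplexed_mul t _ _ hF']
  have : (fun s => (F s : Matrix (Fin 2) (Fin 2) ℂ) * star (F s : Matrix (Fin 2) (Fin 2) ℂ)) =
      fun _ => 1 := funext fun s => Matrix.mem_unitaryGroup_iff.mp (F s).2
  rw [this, multiplexed_one]

theorem applyOn_multiplexed [DecidableEq V] (f : V ↪ W) (v : V)
    (F : Bits V → Matrix (Fin 2) (Fin 2) ℂ) :
    applyOn f (multiplexed v F) = multiplexed (f v) fun s => F (s ∘ f) := by
  ext s t
  rw [applyOn_apply, multiplexed_apply, multiplexed_apply]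
  by_cases h : ∀ w, w ≠ f v → s w = t w
  · rw [if_pos h, if_pos, if_pos]
    · rfl
    · exact fun v' hv' => h _ fun h' => hv' (f.injective h')
    · exact fun w hw => h w (hw v).symm
  · rw [if_neg h]
    split_ifs with h1 h2
    · exfalso
      refine h fun w hw => ?_
      by_cases hwf : ∃ v, f v = w
      · obtain ⟨v', rfl⟩ := hwf
        exact h2 v' fun hv' => hw (congrArg f hv')
      · exact h1 w fun v hv => hwf ⟨v, hv⟩
    · rfl
    · rfl

end Multiplexed

/-! ### Products of primitive gates -/

section Gates

variable {V W : Type} [Fintype V] [DecidableEq V] [Fintype W] [DecidableEq W]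

/-- The group of one-qubit unitaries. -/
abbrev QubitUnitary : Type := Matrix.unitaryGroup (Fin 2) ℂ

/-- A family of one-qubit unitaries on the wire `t`, selected by the other bits. -/
def multiplexedU (t : W) (F : Bits W → QubitUnitary) : Op W :=
  multiplexed t fun s => (F s : Matrix (Fin 2) (Fin 2) ℂ)

theorem multiplexedU_mul {t : W} {F : Bits W → QubitUnitary} (G : Bits W → QubitUnitary)
    (hF : IgnoresBit t F) :
    multiplexedU t F * multiplexedU t G = multiplexedU t fun s => F s * G s :=
  multiplexed_mul t _ _ fun s s' h => by simp only [hF s s' h]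

theorem multiplexedU_star {t : W} {F : Bits W → QubitUnitary} (hF : IgnoresBit t F) :
    star (multiplexedU t F) = multiplexedU t fun s => (F s)⁻¹ :=
  multiplexed_star t _ fun s s' h => by simp only [hF s s' h]

theorem applyOn_multiplexedU (f : V ↪ W) (v : V) (F : Bits V → QubitUnitary) :
    applyOn f (multiplexedU v F) = multiplexedU (f v) fun s => F (s ∘ f) :=
  applyOn_multiplexed f v _

/-- The operator performed by a gate. -/
noncomputable def Gate.toOp (g : Gate W) : Op W := applyOn g.wires (g.op : Op (Fin g.arity))

/-- A one-qubit gate. -/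
def Gate.single (t : W) (M : QubitUnitary) : Gate W where
  arity := 1
  one_le_arity := le_rfl
  arity_le_two := one_le_two
  wires := ⟨fun _ => t, fun _ _ _ => Subsingleton.elim _ _⟩
  op := ⟨multiplexedU 0 fun _ => M, multiplexed_mem_unitaryGroup _ _ fun _ _ _ => rfl⟩

/-- A one-qubit unitary on the wire `t`, selected by the bit on the wire `c`. -/
def Gate.select (c t : W) (hct : c ≠ t) (M : Fin 2 → QubitUnitary) : Gate W where
  arity := 2
  one_le_arity := one_le_two
  arity_le_two := le_rfl
  wires := ⟨![c, t], by
    intro i j hij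
    fin_cases i <;> fin_cases j <;> simp_all [hct.symm]⟩
  op := ⟨multiplexedU 1 fun s => M (s 0), multiplexed_mem_unitaryGroup _ _
    fun s s' h => by simp only [h 0 (by decide)]⟩

theorem Gate.toOp_single (t : W) (M : QubitUnitary) :
    (Gate.single t M).toOp = multiplexedU t fun _ => M :=
  applyOn_multiplexedU (Gate.single t M).wires (0 : Fin 1) fun _ => M

theorem Gate.toOp_select (c t : W) (hct : c ≠ t) (M : Fin 2 → QubitUnitary) :
    (Gate.select c t hct M).toOp = multiplexedU t fun s => M (s c) :=
  applyOn_multiplexedU (Gate.select c t hct M).wires (1 : Fin 2)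
    fun s : Bits (Fin 2) => M (s 0)

/-- `G` is a product of at most `N` primitive gates. -/
def IsGateProduct (N : ℕ) (G : Op W) : Prop :=
  ∃ gs : List (Gate W), gs.length ≤ N ∧ (gs.map Gate.toOp).prod = G

theorem Gate.isGateProduct (g : Gate W) : IsGateProduct 1 g.toOp :=
  ⟨[g], by simp, by simp⟩

theorem IsGateProduct.one : IsGateProduct 0 (1 : Op W) := ⟨[], by simp, by simp⟩

theorem IsGateProduct.mono {N N' : ℕ} {G : Op W} (h : IsGateProduct N G) (hN : N ≤ N') :
    IsGateProduct N' G :=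
  let ⟨gs, h1, h2⟩ := h
  ⟨gs, h1.trans hN, h2⟩

theorem IsGateProduct.mul {N N' : ℕ} {G H : Op W} (hG : IsGateProduct N G)
    (hH : IsGateProduct N' H) : IsGateProduct (N + N') (G * H) := by
  obtain ⟨gs, h1, rfl⟩ := hG
  obtain ⟨hs, h2, rfl⟩ := hH
  exact ⟨gs ++ hs, by simpa using add_le_add h1 h2, by simp⟩

theorem IsGateProduct.star {N : ℕ} {G : Op W} (hG : IsGateProduct N G) :
    IsGateProduct N (star G) := by
  obtain ⟨gs, h1, rfl⟩ := hG
  refine ⟨(gs.map fun g => { g with op := g.op⁻¹ }).reverse, by simpa using h1, ?_⟩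
  clear h1
  induction gs with
  | nil => simp
  | cons g gs ih =>
    simp only [List.map_cons, List.reverse_cons, List.map_append, List.prod_append, ih,
      List.map_nil, List.prod_cons, List.prod_nil, mul_one, star_mul]
    congr 1
    exact applyOn_star g.wires _

theorem IsGateProduct.applyOn {N : ℕ} {G : Op V} (hG : IsGateProduct N G) (f : V ↪ W) :
    IsGateProduct N (applyOn f G) := by
  obtain ⟨gs, h1, rfl⟩ := hG
  refine ⟨gs.map fun g => { g with wires := g.wires.trans f }, by simpa using h1, ?_⟩
  clear h1
  induction gs with
  | nil => simp [applyOn_one]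
  | cons g gs ih =>
    simp only [List.map_cons, List.prod_cons, ih, applyOn_mul]
    congr 1
    exact (applyOn_applyOn g.wires f _).symm

/-! ### Multiply controlled gates from commutators -/

/-- Every conjugate of `z` is a commutator of conjugates of `z` whose inverses are conjugates of
`z` as well. -/
theorem IsConj.exists_commutator {Γ : Type*} [Group Γ] {z u v g : Γ} (hz : u * v * u⁻¹ * v⁻¹ = z)
    (hu : IsConj z u) (hv : IsConj z v) (hinv : IsConj z z⁻¹) (hg : IsConj z g) :
    ∃ u' v' : Γ, u' * v' * u'⁻¹ * v'⁻¹ = g ∧ IsConj z u' ∧ IsConj z v' ∧ IsConj z u'⁻¹ ∧ IsConj z v'⁻¹ := by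
  have key : ∀ {a : Γ}, IsConj z a → IsConj z a⁻¹ := by
    intro a ha
    obtain ⟨c, rfl⟩ := isConj_iff.mp ha
    refine hinv.trans (isConj_iff.mpr ⟨c, ?_⟩)
    group
  obtain ⟨c, rfl⟩ := isConj_iff.mp hg
  have hu' : IsConj z (c * u * c⁻¹) := hu.trans (isConj_iff.mpr ⟨c, rfl⟩)
  have hv' : IsConj z (c * v * c⁻¹) := hv.trans (isConj_iff.mpr ⟨c, rfl⟩)
  refine ⟨_, _, ?_, hu', hv', key hu', key hv'⟩
  rw [← hz]
  group

/-- If the conjugacy class of `z` is closed under taking commutator factors, then its elements,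
controlled by `2 ^ r` bits, are products of `4 ^ r` gates. -/
theorem isGateProduct_controlled {z u v : QubitUnitary} (hz : u * v * u⁻¹ * v⁻¹ = z)
    (hu : IsConj z u) (hv : IsConj z v) (hinv : IsConj z z⁻¹) (p : Bits W) (t : W) (r : ℕ) :
    ∀ (S : Finset W) (g : QubitUnitary), t ∉ S → S.card ≤ 2 ^ r → IsConj z g →
      IsGateProduct (4 ^ r) (multiplexedU t fun s => if ∀ c ∈ S, s c = p c then g else 1) := by
  induction r with
  | zero =>
    intro S g ht hS _
    rw [pow_zero] at hS ⊢
    rcases Nat.le_one_iff_eq_zero_or_eq_one.mp hS with h | h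
    · rw [Finset.card_eq_zero] at h
      subst h
      have := (Gate.single t g).isGateProduct
      rw [Gate.toOp_single] at this
      simpa using this
    · obtain ⟨c, rfl⟩ := Finset.card_eq_one.mp h
      have hct : c ≠ t := by simpa [eq_comm] using ht
      have := (Gate.select c t hct fun b => if b = p c then g else 1).isGateProduct
      rw [Gate.toOp_select] at this
      simpa using this
  | succ r ih =>
    intro S g ht hS hg
    obtain ⟨u', v', rfl, h1, h2, h3, h4⟩ := IsConj.exists_commutator hz hu hv hinv hg
    obtain ⟨A, hAS, hA⟩ := Finset.exists_subset_card_eq (Nat.min_le_right (2 ^ r) S.card)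
    have hB : (S \ A).card ≤ 2 ^ r := by
      rw [Finset.card_sdiff_of_subset hAS, hA]
      rw [pow_succ] at hS
      omega
    have htA : t ∉ A := fun h => ht (hAS h)
    have htB : t ∉ S \ A := fun h => ht (Finset.sdiff_subset h)
    have hA' : A.card ≤ 2 ^ r := hA.trans_le (min_le_left _ _)
    have hign : ∀ (B : Finset W) (g : QubitUnitary), t ∉ B →
        IgnoresBit t fun s => if ∀ c ∈ B, s c = p c then g else 1 := by
      intro B g hB s s' h
      have : (∀ c ∈ B, s c = p c) ↔ ∀ c ∈ B, s' c = p c :=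
        forall₂_congr fun c hc => by rw [h c fun h' => hB (h' ▸ hc)]
      simp only [this]
    -- With u' controlled by `A` and v' by `S \ A`, the commutator reduces to 1 as soon as one of
    -- the two patterns fails, and is the wanted gate when both match. Its four factors give the
    -- recursion 4 · 4 ^ r.
    have hprod := (((ih A u' htA hA' h1).mul (ih _ v' htB hB h2)).mul
      (ih A _ htA hA' h3)).mul (ih _ _ htB hB h4)
    have hS' : ∀ s : Bits W, (∀ c ∈ S, s c = p c) ↔
        (∀ c ∈ A, s c = p c) ∧ ∀ c ∈ S \ A, s c = p c := by
      intro s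
      refine ⟨fun h => ⟨fun c hc => h c (hAS hc), fun c hc => h c (Finset.sdiff_subset hc)⟩,
        fun h c hc => ?_⟩
      by_cases hcA : c ∈ A
      · exact h.1 c hcA
      · exact h.2 c (Finset.mem_sdiff.mpr ⟨hc, hcA⟩)
    have ignores_mul : ∀ {F G : Bits W → QubitUnitary}, IgnoresBit t F → IgnoresBit t G →
        IgnoresBit t fun s => F s * G s := by
      intro F G hF hG s s' h
      simp only [hF s s' h, hG s s' h]
    rw [multiplexedU_mul _ (hign _ _ htA),
      multiplexedU_mul _ (ignores_mul (hign _ _ htA) (hign _ _ htB)),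
      multiplexedU_mul _ (ignores_mul (ignores_mul (hign _ _ htA) (hign _ _ htB))
        (hign _ _ htA))] at hprod
    convert hprod using 1
    · ring
    · congr 1
      funext s
      rw [if_congr (hS' s) rfl rfl]
      by_cases hA : ∀ c ∈ A, s c = p c <;> by_cases hB : ∀ c ∈ S \ A, s c = p c
      · rw [if_pos ⟨hA, hB⟩, if_pos hA, if_pos hB, if_pos hA, if_pos hB]
      · rw [if_neg fun h => hB h.2, if_pos hA, if_neg hB, if_pos hA, if_neg hB]
        simp
      · rw [if_neg fun h => hA h.1, if_neg hA, if_pos hB, if_neg hA, if_pos hB]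
        simp
      · rw [if_neg fun h => hA h.1, if_neg hA, if_neg hB, if_neg hA, if_neg hB]
        simp

/-- Rotations about the `y`-axis. -/
noncomputable def rotY (θ : ℝ) : QubitUnitary :=
  ⟨!![(Real.cos θ : ℂ), -(Real.sin θ : ℂ); (Real.sin θ : ℂ), (Real.cos θ : ℂ)], by
    have h : (Real.cos θ : ℂ) * Real.cos θ + Real.sin θ * Real.sin θ = 1 := by
      exact_mod_cast (by nlinarith [Real.sin_sq_add_cos_sq θ] :
        Real.cos θ * Real.cos θ + Real.sin θ * Real.sin θ = 1)
    rw [Matrix.mem_unitaryGroup_iff]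
    ext i j
    fin_cases i <;> fin_cases j <;>
      simp [Matrix.mul_apply, Matrix.star_apply, -Complex.ofReal_cos, -Complex.ofReal_sin]
    · linear_combination h
    · ring
    · ring
    · linear_combination h⟩

/-- The Pauli matrix `Z`. -/
def pauliZ : QubitUnitary :=
  ⟨!![1, 0; 0, -1], by
    rw [Matrix.mem_unitaryGroup_iff]
    ext i j
    fin_cases i <;> fin_cases j <;> simp [Matrix.mul_apply, Matrix.star_apply]⟩

theorem rotY_mul (θ φ : ℝ) : rotY θ * rotY φ = rotY (θ + φ) := by
  apply Subtype.ext
  ext i j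
  fin_cases i <;> fin_cases j <;>
    simp [rotY, Complex.cos_add, Complex.sin_add] <;> ring

theorem pauliZ_mul_rotY_mul_pauliZ (θ : ℝ) : pauliZ * rotY θ * pauliZ = rotY (-θ) := by
  apply Subtype.ext
  ext i j
  fin_cases i <;> fin_cases j <;> simp [rotY, pauliZ]

/-- The rotation `-𝐢 Y`, which flips a qubit up to signs. -/
noncomputable def flipY : QubitUnitary :=
  ⟨!![0, 1; -1, 0], by
    rw [Matrix.mem_unitaryGroup_iff]
    ext i j
    fin_cases i <;> fin_cases j <;> simp [Matrix.mul_apply, Matrix.star_apply]⟩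

/-- Commutators have determinant 1, so the Pauli matrix X would not do. Here u = 𝐢Z and v = 𝐢H, with
H the Hadamard matrix, are half-turns about axes at 45°: their product is a quarter-turn and their
commutator a half-turn. All traceless elements of SU(2) have eigenvalues ±𝐢 and are therefore
conjugate; `a`, `b` and `u` itself are explicit conjugating matrices. -/
theorem exists_commutator_eq_flipY : ∃ u v : QubitUnitary,
    u * v * u⁻¹ * v⁻¹ = flipY ∧ IsConj flipY u ∧ IsConj flipY v ∧ IsConj flipY flipY⁻¹ := by
  obtain ⟨s, hs⟩ : ∃ s : ℝ, (s : ℂ) * s = 1 / 2 := by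
    refine ⟨√(1 / 2), ?_⟩
    rw [← Complex.ofReal_mul, Real.mul_self_sqrt (by norm_num)]
    norm_num
  have hI : Complex.I * Complex.I = -1 := Complex.I_mul_I
  obtain ⟨u, hu⟩ : ∃ u : QubitUnitary, (u : Matrix (Fin 2) (Fin 2) ℂ) =
      !![Complex.I, 0; 0, -Complex.I] := by
    refine ⟨⟨_, ?_⟩, rfl⟩
    rw [Matrix.mem_unitaryGroup_iff]
    ext i j
    fin_cases i <;> fin_cases j <;> simp [Matrix.mul_apply, Matrix.star_apply]
  obtain ⟨v, hv⟩ : ∃ v : QubitUnitary, (v : Matrix (Fin 2) (Fin 2) ℂ) =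
      !![Complex.I * s, Complex.I * s; Complex.I * s, -(Complex.I * s)] := by
    refine ⟨⟨_, ?_⟩, rfl⟩
    rw [Matrix.mem_unitaryGroup_iff]
    ext i j
    fin_cases i <;> fin_cases j <;> simp [Matrix.mul_apply, Matrix.star_apply]
    all_goals linear_combination (2 : ℂ) * hs - 2 * s * s * hI
  obtain ⟨a, ha⟩ : ∃ a : QubitUnitary, (a : Matrix (Fin 2) (Fin 2) ℂ) =
      !![(s : ℂ), -Complex.I * s; s, Complex.I * s] := by
    refine ⟨⟨_, ?_⟩, rfl⟩
    rw [Matrix.mem_unitaryGroup_iff]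
    ext i j
    fin_cases i <;> fin_cases j <;> simp [Matrix.mul_apply, Matrix.star_apply]
    all_goals first
      | linear_combination (2 : ℂ) * hs - s * s * hI
      | linear_combination (s * s : ℂ) * hI
  obtain ⟨b, hb⟩ : ∃ b : QubitUnitary, (b : Matrix (Fin 2) (Fin 2) ℂ) =
      !![Complex.I * (s * s), s + Complex.I * (s * s); -s + Complex.I * (s * s),
      -(Complex.I * (s * s))] := by
    refine ⟨⟨_, ?_⟩, rfl⟩
    rw [Matrix.mem_unitaryGroup_iff]
    ext i j
    fin_cases i <;> fin_cases j <;> simp [Matrix.mul_apply, Matrix.star_apply]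
    all_goals first
      | linear_combination (2 * s * s + 2 : ℂ) * hs - 2 * s ^ 4 * hI
      | ring
  have conj_of : ∀ {g h k : QubitUnitary}, k * g = h * k → IsConj g h := by
    intro g h k hk
    exact isConj_iff.mpr ⟨k, by rw [hk]; group⟩
  refine ⟨u, v, ?_, conj_of (k := a) ?_, conj_of (k := b) ?_, conj_of (k := u) ?_⟩
  · have : u * v = flipY * v * u := by
      apply Subtype.ext
      ext i j
      fin_cases i <;> fin_cases j <;> simp [hu, hv, flipY]
      all_goals ring
    rw [this]
    group
  · apply Subtype.ext
    ext i j
    fin_cases i <;> fin_cases j <;> simp [hu, ha, flipY]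
    all_goals linear_combination (s : ℂ) * hI
  · apply Subtype.ext
    ext i j
    fin_cases i <;> fin_cases j <;> simp [hv, hb, flipY]
    all_goals first
      | linear_combination -2 * (s : ℂ) ^ 3 * hI + 2 * s * hs
      | ring
  · rw [eq_comm, inv_mul_eq_iff_eq_mul]
    apply Subtype.ext
    ext i j
    fin_cases i <;> fin_cases j <;> simp [hu, flipY]

end Gates

/-! ### State preparation -/

section StatePreparation

variable {W : Type} [Fintype W] [DecidableEq W]

/-- A multiplexed rotation with `m` control bits is a product of `3 * 2 ^ m - 2` gates. -/
theorem isGateProduct_multiplexed_rotY (t : W) (S : Finset W) :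
    t ∉ S → ∀ θ : Bits W → ℝ, (∀ s s' : Bits W, (∀ c ∈ S, s c = s' c) → θ s = θ s') →
      IsGateProduct (3 * 2 ^ S.card - 2) (multiplexedU t fun s => rotY (θ s)) := by
  induction S using Finset.induction_on with
  | empty =>
    intro _ θ hθ
    have := (Gate.single t (rotY (θ 0))).isGateProduct
    rw [Gate.toOp_single] at this
    have h : (fun s : Bits W => rotY (θ s)) = fun _ => rotY (θ 0) :=
      funext fun s => by rw [hθ s 0 (by simp)]
    rw [h]
    exact this
  | insert c S hc ih =>
    intro ht θ hθ
    have hct : c ≠ t := fun h => ht (h ▸ Finset.mem_insert_self _ _)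
    have htS : t ∉ S := fun h => ht (Finset.mem_insert_of_mem h)
    have hupd : ∀ (b : Fin 2) (s s' : Bits W), (∀ w ∈ S, s w = s' w) →
        θ (Function.update s c b) = θ (Function.update s' c b) := by
      intro b s s' h
      refine hθ _ _ fun w hw => ?_
      by_cases hwc : w = c
      · subst hwc; simp
      · simpa [hwc] using h w (Finset.mem_of_mem_insert_of_ne hw hwc)
    -- Half-sum and half-difference of the two angles selected by `c`: since Z reverses rotations,
    -- R(α) Z^c R(β) Z^c is R(α + β) for c = 0 and R(α - β) for c = 1.
    let α : Bits W → ℝ := fun s =>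
      (θ (Function.update s c 0) + θ (Function.update s c 1)) / 2
    let β : Bits W → ℝ := fun s =>
      (θ (Function.update s c 0) - θ (Function.update s c 1)) / 2
    have hα : ∀ s s' : Bits W, (∀ w ∈ S, s w = s' w) → α s = α s' := fun s s' h => by
      simp only [α, hupd 0 s s' h, hupd 1 s s' h]
    have hβ : ∀ s s' : Bits W, (∀ w ∈ S, s w = s' w) → β s = β s' := fun s s' h => by
      simp only [β, hupd 0 s s' h, hupd 1 s s' h]
    have ign : ∀ γ : Bits W → ℝ, (∀ s s' : Bits W, (∀ w ∈ S, s w = s' w) → γ s = γ s') →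
        IgnoresBit t fun s => rotY (γ s) := fun γ hγ s s' h => by
      simp only [hγ s s' fun w hw => h w fun h' => htS (h' ▸ hw)]
    let Z : Fin 2 → QubitUnitary := fun b => if b = 0 then 1 else pauliZ
    have hZ := (Gate.select c t hct Z).isGateProduct
    rw [Gate.toOp_select] at hZ
    have ignZ : IgnoresBit t fun s => Z (s c) := fun s s' h => by simp only [h c hct]
    have ignmul : ∀ {F G : Bits W → QubitUnitary}, IgnoresBit t F → IgnoresBit t G →
        IgnoresBit t fun s => F s * G s := by
      intro F G hF hG s s' h
      simp only [hF s s' h, hG s s' h]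
    have hprod := (((ih htS α hα).mul hZ).mul (ih htS β hβ)).mul hZ
    rw [multiplexedU_mul _ (ign α hα), multiplexedU_mul _ (ignmul (ign α hα) ignZ),
      multiplexedU_mul _ (ignmul (ignmul (ign α hα) ignZ) (ign β hβ))] at hprod
    have hF : (fun s => rotY (θ s)) =
        fun s => rotY (α s) * Z (s c) * rotY (β s) * Z (s c) := by
      funext s
      by_cases hs : s c = 0
      · have h0 : Function.update s c 0 = s := by rw [← hs, Function.update_eq_self]
        simp only [Z, hs, if_true, mul_one, rotY_mul, α, β, h0]
        congr 1
        ring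
      · have hs1 : s c = 1 := by omega
        have h1 : Function.update s c 1 = s := by rw [← hs1, Function.update_eq_self]
        simp only [Z, hs, if_false, mul_assoc]
        rw [← mul_assoc pauliZ, pauliZ_mul_rotY_mul_pauliZ, rotY_mul]
        simp only [α, β, h1]
        congr 1
        ring
    rw [hF]
    -- Two multiplexed rotations with one control fewer and two controlled Z gates: 2 (3 · 2^m - 2)
    -- + 2 = 3 · 2^{m+1} - 2.
    refine hprod.mono ?_
    rw [Finset.card_insert_of_notMem hc, pow_succ]
    have := Nat.one_le_two_pow (n := S.card)
    omega

/-- Every unit vector of `L` qubits with nonnegative amplitudes can be prepared with `3 * 2 ^ L`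
gates. -/
theorem exists_statePreparation (L : ℕ) : ∀ a : Bits (Fin L) → ℝ, (∀ s, 0 ≤ a s) →
    ∑ s, a s ^ 2 = 1 → ∃ P : Op (Fin L), IsGateProduct (3 * 2 ^ L) P ∧ ∀ s, P s 0 = a s := by
  induction L with
  | zero =>
    intro a ha h
    refine ⟨1, IsGateProduct.one.mono (Nat.zero_le _), fun s => ?_⟩
    have h0 : ∀ s : Bits (Fin 0), s = 0 := fun s => Subsingleton.elim _ _
    rw [Fintype.sum_subsingleton _ s] at h
    have h1 : a s = 1 := (pow_eq_one_iff_of_nonneg (ha s) two_ne_zero).mp h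
    rw [h1, h0 s, Matrix.one_apply_eq, Complex.ofReal_one]
  | succ L ih =>
    intro a _ h
    -- The two amplitudes that differ in the first qubit form one complex number. Its modulus is the
    -- amplitude to prepare on the other L qubits, and its argument is the angle by which the first
    -- qubit is then rotated.
    let z : Bits (Fin L) → ℂ := fun s => ⟨a (Fin.cons 0 s), a (Fin.cons 1 s)⟩
    have hsplit : ∀ F : Bits (Fin (L + 1)) → ℝ,
        ∑ s, F s = ∑ s : Bits (Fin L), (F (Fin.cons 0 s) + F (Fin.cons 1 s)) := by
      intro F
      rw [← (Fin.consEquiv fun _ : Fin (L + 1) => Fin 2).sum_comp, Fintype.sum_prod_type,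
        Fin.sum_univ_two, ← Finset.sum_add_distrib]
      rfl
    obtain ⟨P, hP, hPa⟩ := ih (fun s => ‖z s‖) (fun s => norm_nonneg _) (by
      rw [hsplit] at h
      rw [← h]
      refine Finset.sum_congr rfl fun s _ => ?_
      rw [Complex.sq_norm, Complex.normSq_apply]
      simp only [z]
      ring)
    let θ : Bits (Fin (L + 1)) → ℝ := fun s => (z (Fin.tail s)).arg
    have hθ : ∀ s s' : Bits (Fin (L + 1)), (∀ c ∈ Finset.univ.erase 0, s c = s' c) →
        θ s = θ s' := by
      intro s s' hs
      simp only [θ]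
      congr 2
      funext i
      exact hs i.succ (by simp)
    have hR := isGateProduct_multiplexed_rotY (0 : Fin (L + 1)) (Finset.univ.erase 0)
      (by simp) θ hθ
    refine ⟨_, (hR.mul (hP.applyOn (Fin.succEmb L))).mono ?_, fun s => ?_⟩
    · rw [Finset.card_erase_of_mem (Finset.mem_univ _), Finset.card_univ, Fintype.card_fin,
        Nat.add_sub_cancel, pow_succ]
      omega
    · have htail : ∀ b : Fin 2, (Function.update s 0 b) ∘ (Fin.succEmb L) =
          Fin.tail s := by
        intro b
        funext i
        simp [Fin.tail]
      have hrange : ∀ w : Fin (L + 1), (∀ v, (Fin.succEmb L) v ≠ w) → w = 0 := by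
        intro w hw
        by_contra hne
        exact hw (w.pred hne) (by simp)
      have happ : ∀ b : Fin 2, applyOn (Fin.succEmb L) P (Function.update s 0 b) 0 =
          if b = 0 then P (Fin.tail s) 0 else 0 := by
        intro b
        rw [applyOn_apply, htail]
        by_cases hb : b = 0
        · rw [if_pos hb, if_pos fun w hw => by rw [hrange w hw]; simpa using hb]
          rfl
        · rw [if_neg hb, if_neg fun h => hb (by simpa using h 0 fun v => by simp)]
      rw [multiplexedU, multiplexed_mul_apply _ _ (fun s s' h => by
        simp only [hθ s s' fun c hc => h c (Finset.ne_of_mem_erase hc)]), Fin.sum_univ_two,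
        happ, happ, if_pos rfl, if_neg (by simp), mul_zero, add_zero, hPa]
      have hs : s = Fin.cons (s 0) (Fin.tail s) := (Fin.cons_self_tail s).symm
      rcases (by omega : s 0 = 0 ∨ s 0 = 1) with h0 | h0
      · have : a s = (z (Fin.tail s)).re := by
          simp only [z]
          rw [← h0, ← hs]
        rw [h0, this, ← Complex.norm_mul_cos_arg]
        simp [rotY, θ, -Complex.norm_mul_cos_arg, mul_comm]
      · have : a s = (z (Fin.tail s)).im := by
          simp only [z]
          rw [← h0, ← hs]
        rw [h0, this, ← Complex.norm_mul_sin_arg]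
        simp [rotY, θ, -Complex.norm_mul_sin_arg, mul_comm]

end StatePreparation

/-! ### Circuits and their costs -/

section CircuitLemmas

variable {W V O : Type} [Fintype W] [DecidableEq W] [Fintype V] [DecidableEq V]

theorem Circuit.eval_append (U : O → Op V) (c d : Circuit W V O) :
    Circuit.eval U (c ++ d) = Circuit.eval U d * Circuit.eval U c := by
  induction c with
  | nil => simp [Circuit.eval]
  | cons s c ih =>
    change Circuit.eval U (c ++ d) * s.eval U = _
    rw [ih, mul_assoc]
    rfl

theorem controlled_star (U : Op V) : star (controlled U) = controlled (star U) := by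
  ext s t
  rw [Matrix.star_apply]
  simp only [controlled, Matrix.of_apply]
  by_cases h : s (Sum.inl ()) = t (Sum.inl ())
  · rw [if_neg (not_not.mpr h.symm), if_neg (not_not.mpr h), h]
    split_ifs
    · rw [← Matrix.star_apply, star_one]
    · rfl
  · rw [if_pos (Ne.symm h), if_pos h, star_zero]

theorem controlled_mul (U U' : Op V) :
    controlled U * controlled U' = controlled (U * U') := by
  ext s t
  have hsum : ∀ F : Bits (Unit ⊕ V) → ℂ, ∑ r, F r =
      ∑ b : Fin 2, ∑ u : Bits V, F (Sum.elim (fun _ => b) u) := by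
    intro F
    rw [← (Equiv.sumArrowEquivProdArrow Unit V (Fin 2)).symm.sum_comp, Fintype.sum_prod_type,
      ← (Equiv.funUnique Unit (Fin 2)).symm.sum_comp]
    rfl
  rw [Matrix.mul_apply, hsum, Finset.sum_eq_single (s (Sum.inl ()))]
  · simp only [controlled, Matrix.of_apply, Sum.elim_inl, ne_eq, not_true_eq_false, if_false]
    by_cases h : s (Sum.inl ()) = t (Sum.inl ())
    · simp only [h, not_true_eq_false, if_false]
      by_cases h0 : t (Sum.inl ()) = 0
      · simp only [h0, if_true]
        rw [← mul_one (1 : Op V), Matrix.mul_apply, mul_one]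
        rfl
      · simp only [h0, if_false]
        rw [Matrix.mul_apply]
        rfl
    · simp [h]
  · intro b _ hb
    refine Finset.sum_eq_zero fun u _ => ?_
    simp [controlled, hb.symm]
  · simp

theorem controlled_mem_unitaryGroup {U : Op V} (hU : U ∈ Matrix.unitaryGroup (Bits V) ℂ) :
    controlled U ∈ Matrix.unitaryGroup (Bits (Unit ⊕ V)) ℂ := by
  rw [Matrix.mem_unitaryGroup_iff] at hU ⊢
  rw [controlled_star, controlled_mul, hU]
  ext s t
  simp only [controlled, Matrix.of_apply, Matrix.one_apply]
  by_cases hst : s = t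
  · subst hst; simp
  · rw [if_neg hst]
    by_cases h : s (Sum.inl ()) = t (Sum.inl ())
    · have : s ∘ Sum.inr ≠ t ∘ Sum.inr := fun h' => hst (funext fun w => by
        rcases w with _ | v
        · exact h
        · exact congrFun h' v)
      simp [this]
    · simp [h]

theorem Circuit.eval_mem_unitaryGroup {U : O → Op V}
    (hU : ∀ o, U o ∈ Matrix.unitaryGroup (Bits V) ℂ) (c : Circuit W V O) :
    Circuit.eval U c ∈ Matrix.unitaryGroup (Bits W) ℂ := by
  induction c with
  | nil => exact one_mem _
  | cons s c ih =>
    refine mul_mem ih ?_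
    cases s with
    | layer gates _ =>
      refine list_prod_mem fun g hg => ?_
      obtain ⟨g, _, rfl⟩ := List.mem_map.mp hg
      exact applyOn_mem_unitaryGroup _ g.op.2
    | query o place => exact applyOn_mem_unitaryGroup _ (controlled_mem_unitaryGroup (hU o))

/-- The operator `E`, which depends on the black boxes, is performed by a circuit with at most `q`
queries, `s` gates and `d` layers. -/
def HasCircuit (q s d : ℕ) (E : (O → Op V) → Op W) : Prop :=
  ∃ c : Circuit W V O, c.queries ≤ q ∧ c.size ≤ s ∧ c.depth ≤ d ∧ ∀ U, Circuit.eval U c = E U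

theorem HasCircuit.mul {q s d q' s' d' : ℕ} {E E' : (O → Op V) → Op W}
    (h : HasCircuit q s d E) (h' : HasCircuit q' s' d' E') :
    HasCircuit (q + q') (s + s') (d + d') fun U => E U * E' U := by
  obtain ⟨c, h1, h2, h3, h4⟩ := h
  obtain ⟨c', h1', h2', h3', h4'⟩ := h'
  refine ⟨c' ++ c, ?_, ?_, ?_, fun U => by rw [Circuit.eval_append, h4, h4']⟩
  · simp only [Circuit.queries, List.map_append, List.sum_append] at *; omega
  · simp only [Circuit.size, List.map_append, List.sum_append] at *; omega
  · simp only [Circuit.depth, List.map_append, List.sum_append] at *; omega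

theorem HasCircuit.one : HasCircuit 0 0 0 fun _ : O → Op V => (1 : Op W) :=
  ⟨[], by simp [Circuit.queries], by simp [Circuit.size], by simp [Circuit.depth], fun _ => rfl⟩

theorem HasCircuit.list_prod {ι : Type} {q s d : ℕ} {E : ι → (O → Op V) → Op W} (l : List ι)
    (h : ∀ i, HasCircuit q s d (E i)) :
    HasCircuit (l.length * q) (l.length * s) (l.length * d)
      fun U => (l.map fun i => E i U).prod := by
  induction l with
  | nil => simpa using HasCircuit.one
  | cons i l ih =>
    have := (h i).mul ih
    simpa only [List.length_cons, List.map_cons, List.prod_cons, add_mul, one_mul, add_comm]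
      using this

theorem hasCircuit_query (o : O) (place : (Unit ⊕ V) ↪ W) :
    HasCircuit 1 0 0 fun U : O → Op V => applyOn place (controlled (U o)) :=
  ⟨[Step.query o place], by simp [Circuit.queries, Step.queries],
    by simp [Circuit.size, Step.size], by simp [Circuit.depth, Step.depth],
    fun U => by simp [Circuit.eval, Step.eval]⟩

theorem hasCircuit_layer (gates : List (Gate W)) (h : gates.Pairwise Gate.DisjointWires) :
    HasCircuit 0 gates.length 1 fun _ : O → Op V => (gates.map Gate.toOp).prod :=
  ⟨[Step.layer gates h], by simp [Circuit.queries, Step.queries],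
    by simp [Circuit.size, Step.size], by simp [Circuit.depth, Step.depth],
    fun U => by simp only [Circuit.eval, Step.eval, one_mul]; rfl⟩

theorem IsGateProduct.hasCircuit {N : ℕ} {G : Op W} (h : IsGateProduct N G) :
    HasCircuit 0 N N fun _ : O → Op V => G := by
  obtain ⟨gs, hN, rfl⟩ := h
  have h1 : ∀ g : Gate W, HasCircuit 0 1 1 fun _ : O → Op V => g.toOp := fun g => by
    simpa using hasCircuit_layer (V := V) (O := O) [g] (by simp)
  obtain ⟨c, h2, h3, h4, h5⟩ := HasCircuit.list_prod gs h1
  exact ⟨c, by simpa using h2, (by simpa using h3 : _ ≤ gs.length).trans hN,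
    (by simpa using h4 : _ ≤ gs.length).trans hN, h5⟩

end CircuitLemmas

/-! ### Operators on subsets of the computational basis -/

section Columns

variable {W V V' : Type} [Fintype W] [DecidableEq W] [Fintype V] [DecidableEq V]

/-- The operators `A` and `B` agree on the span of the basis states in `C`. -/
def AgreeOn (C : Set (Bits W)) (A B : Op W) : Prop := ∀ s, ∀ t ∈ C, A s t = B s t

/-- The operator `A` maps the span of the basis states in `C` into that of those in `D`. -/
def SpanMapsTo (A : Op W) (C D : Set (Bits W)) : Prop := ∀ s, ∀ t ∈ C, A s t ≠ 0 → s ∈ D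

theorem AgreeOn.refl (C : Set (Bits W)) (A : Op W) : AgreeOn C A A := fun _ _ _ => rfl

theorem AgreeOn.trans {C : Set (Bits W)} {A B D : Op W} (h : AgreeOn C A B)
    (h' : AgreeOn C B D) : AgreeOn C A D := fun s t ht => (h s t ht).trans (h' s t ht)

theorem AgreeOn.mono {C D : Set (Bits W)} {A B : Op W} (h : AgreeOn D A B) (hCD : C ⊆ D) :
    AgreeOn C A B := fun s t ht => h s t (hCD ht)

/-- The left factors are only compared on basis states that `B'` reaches from `C`. This lets a
circuit be simplified on the inputs where the flag and the index have known values. -/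
theorem AgreeOn.mul {C D : Set (Bits W)} {A A' B B' : Op W} (hB : AgreeOn C B B')
    (hA : AgreeOn D A A') (hm : SpanMapsTo B' C D) : AgreeOn C (A * B) (A' * B') := by
  intro s t ht
  rw [Matrix.mul_apply, Matrix.mul_apply]
  refine Finset.sum_congr rfl fun r _ => ?_
  rw [hB r t ht]
  by_cases h : B' r t = 0
  · rw [h, mul_zero, mul_zero]
  · rw [hA s r (hm r t ht h)]

theorem SpanMapsTo.mul {C D E : Set (Bits W)} {A B : Op W} (hB : SpanMapsTo B C D)
    (hA : SpanMapsTo A D E) : SpanMapsTo (A * B) C E := by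
  intro s t ht h
  rw [Matrix.mul_apply] at h
  obtain ⟨r, _, hr⟩ := Finset.exists_ne_zero_of_sum_ne_zero h
  exact hA s r (hB r t ht (right_ne_zero_of_mul hr)) (left_ne_zero_of_mul hr)

theorem spanMapsTo_one (C : Set (Bits W)) : SpanMapsTo (1 : Op W) C C := by
  intro s t ht h
  rw [Matrix.one_apply] at h
  have : s = t := by
    by_contra hne
    exact h (if_neg hne)
  rwa [this]

/-- Basis states that carry `b` on the wire `f` and the pattern `p` on the wires `ι`. -/
def patternSet {L : Type} (f : W) (b : Fin 2) (ι : L → W) (p : Bits L) : Set (Bits W) :=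
  {t | t f = b ∧ t ∘ ι = p}

variable {L : Type}

theorem spanMapsTo_applyOn {f : W} {b : Fin 2} {ι : L → W} {p : Bits L} (g : V ↪ W) (G : Op V)
    (hf : ∀ v, g v ≠ f) (hι : ∀ v i, g v ≠ ι i) :
    SpanMapsTo (applyOn g G) (patternSet f b ι p) (patternSet f b ι p) := by
  intro s t ht h
  refine ⟨(applyOn_support h hf).trans ht.1, ?_⟩
  rw [← ht.2]
  exact funext fun i => applyOn_support h fun v => hι v i

theorem agreeOn_controlled (place : (Unit ⊕ V) ↪ W) (U : Op V) :
    AgreeOn {t | t (place (Sum.inl ())) = 1} (applyOn place (controlled U))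
      (applyOn (Function.Embedding.inr.trans place) U) := by
  intro s t ht
  rw [applyOn_apply, applyOn_apply]
  by_cases h : ∀ w, (∀ v, (Function.Embedding.inr.trans place) v ≠ w) → s w = t w
  · rw [if_pos h, if_pos fun w hw => h w fun v => hw (Sum.inr v)]
    have h1 : s (place (Sum.inl ())) = t (place (Sum.inl ())) :=
      h _ fun v hv => by simpa using place.injective hv
    simp only [controlled, Matrix.of_apply, Function.comp_apply]
    rw [if_neg (not_not.mpr h1), if_neg (by rw [h1, ht]; decide)]
    rfl
  · rw [if_neg h]
    split_ifs with h1
    · simp only [controlled, Matrix.of_apply, Function.comp_apply]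
      rw [if_pos]
      intro h2
      refine h fun w hw => ?_
      by_cases hwp : ∃ v, place v = w
      · obtain ⟨v, rfl⟩ := hwp
        rcases v with v | v
        · exact h2
        · exact absurd rfl (hw v)
      · exact h1 w fun v hv => hwp ⟨v, hv⟩
    · rfl

theorem agreeOn_controlled_one (place : (Unit ⊕ V) ↪ W) (U : Op V) :
    AgreeOn {t | t (place (Sum.inl ())) = 0} (applyOn place (controlled U)) 1 := by
  intro s t ht
  rw [← applyOn_one place, applyOn_apply, applyOn_apply]
  refine if_congr Iff.rfl ?_ rfl
  simp only [controlled, Matrix.of_apply, Function.comp_apply, Matrix.one_apply]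
  by_cases h : s (place (Sum.inl ())) = t (place (Sum.inl ()))
  · rw [if_neg (not_not.mpr h), if_pos (h.trans ht)]
    refine if_congr ⟨fun h' => funext fun v => ?_, fun h' => funext fun v => ?_⟩ rfl rfl
    · rcases v with v | v
      · exact h
      · exact congrFun h' v
    · exact congrFun h' (Sum.inr v)
  · rw [if_pos h, if_neg fun h' => h (congrFun h' (Sum.inl ()))]

/-- The multiply controlled flip of `f`, followed by a use of `C(U)` controlled by `f` and the
inverse flip. -/
noncomputable def selectOp (ι : L → W) (p : Bits L) [Fintype L] [DecidableEq L]
    (place : (Unit ⊕ V) ↪ W) (U : Op V) : Op W :=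
  multiplexedU (place (Sum.inl ())) (fun s => if s ∘ ι = p then flipY else 1) *
    (applyOn place (controlled U) *
      star (multiplexedU (place (Sum.inl ())) fun s => if s ∘ ι = p then flipY else 1))

variable [Fintype L] [DecidableEq L]

theorem agreeOn_multiplexedU_of_forall {C : Set (Bits W)} {t : W} {F G : Bits W → QubitUnitary}
    (h : ∀ s ∈ C, F s = G s) : AgreeOn C (multiplexedU t F) (multiplexedU t G) := by
  intro s s' hs'
  rw [multiplexedU, multiplexedU, multiplexed_apply, multiplexed_apply, h s' hs']

theorem multiplexedU_one (t : W) : multiplexedU t (fun _ => 1) = (1 : Op W) := multiplexed_one t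

theorem spanMapsTo_multiplexedU (f : W) (ι : L → W) (p : Bits L) (hι : ∀ i, ι i ≠ f)
    (F : Bits W → QubitUnitary) (C : Set (Bits W)) (hC : C ⊆ {t | t ∘ ι = p}) :
    SpanMapsTo (multiplexedU f F) C {t | t ∘ ι = p} := by
  intro s t ht h
  rw [Set.mem_ofPred_eq, ← hC ht]
  exact funext fun i => multiplexed_support h (hι i)

/-- If the index matches, the first flip carries the flag from 0 to 1 up to a sign, the controlled
black box acts as `U`, and the last flip cancels the first one exactly, because `U` does not touch
the flag and so commutes with it. Otherwise the flag stays 0 and every factor acts as the identity.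
-/
theorem agreeOn_selectOp (ι : L → W) (p p' : Bits L) (place : (Unit ⊕ V) ↪ W) (U : Op V)
    (hι : ∀ v i, place v ≠ ι i) :
    AgreeOn (patternSet (place (Sum.inl ())) 0 ι p') (selectOp ι p place U)
      (if p = p' then applyOn (Function.Embedding.inr.trans place) U else 1) := by
  set f := place (Sum.inl ()) with hf
  have hιf : ∀ i, ι i ≠ f := fun i => (hι _ i).symm
  have hign : IgnoresBit f fun s => if s ∘ ι = p then flipY else (1 : QubitUnitary) := by
    intro s s' h
    have : s ∘ ι = s' ∘ ι := funext fun i => h _ (hιf i)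
    simp only [this]
  rw [selectOp, ← hf, multiplexedU_star hign]
  split_ifs with hp
  · subst hp
    set u := applyOn (Function.Embedding.inr.trans place) U with hu
    have hconst : IgnoresBit f fun _ : Bits W => flipY := fun _ _ _ => rfl
    have hsub : patternSet f 0 ι p ⊆ {t | t ∘ ι = p} := fun t ht => ht.2
    have h1 : AgreeOn (patternSet f 0 ι p)
        (multiplexedU f fun s => (if s ∘ ι = p then flipY else 1)⁻¹)
        (multiplexedU f fun _ => flipY⁻¹) :=
      agreeOn_multiplexedU_of_forall fun s hs => by rw [if_pos hs.2]
    have h2 : AgreeOn {t | t ∘ ι = p} (multiplexedU f fun s => if s ∘ ι = p then flipY else 1)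
        (multiplexedU f fun _ => flipY) :=
      agreeOn_multiplexedU_of_forall fun s (hs : s ∘ ι = p) => by rw [if_pos hs]
    have m1 : SpanMapsTo (multiplexedU f fun _ => flipY⁻¹) (patternSet f 0 ι p)
        (patternSet f 1 ι p) := by
      intro s t ht h
      refine ⟨?_, spanMapsTo_multiplexedU f ι p hιf _ _ hsub s t ht h⟩
      by_contra hs
      have hs0 : s f = 0 := by omega
      rw [multiplexedU, multiplexed_apply, hs0, ht.1] at h
      simp [flipY] at h
    have m2 : SpanMapsTo u (patternSet f 1 ι p) (patternSet f 1 ι p) :=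
      spanMapsTo_applyOn _ _ (fun v h => by simpa using place.injective h)
        fun v i => hι (Sum.inr v) i
    have h3 : AgreeOn (patternSet f 1 ι p) (applyOn place (controlled U)) u :=
      (agreeOn_controlled place U).mono fun t ht => ht.1
    have h4 := (h1.mul h3 m1).mul h2 fun s t ht h => ((m1.mul m2) s t ht h).2
    have hcomm : Commute (multiplexedU f fun _ : Bits W => flipY) u := by
      rw [← Gate.toOp_single]
      refine applyOn_commute _ _ (fun v v' h => ?_) _ _
      have : place (Sum.inl ()) = place (Sum.inr v') := h
      simpa using place.injective this
    rw [← mul_assoc (multiplexedU f fun _ => flipY), hcomm.eq, mul_assoc,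
      multiplexedU_mul _ hconst] at h4
    simpa [multiplexedU_one] using h4
  · have hne : ∀ s ∈ patternSet f 0 ι p', s ∘ ι ≠ p := fun s hs h => hp (h.symm.trans hs.2)
    have h1 : AgreeOn (patternSet f 0 ι p')
        (multiplexedU f fun s => (if s ∘ ι = p then flipY else 1)⁻¹) 1 := by
      rw [← multiplexedU_one f]
      exact agreeOn_multiplexedU_of_forall fun s hs => by rw [if_neg (hne s hs), inv_one]
    have h2 : AgreeOn (patternSet f 0 ι p')
        (multiplexedU f fun s => if s ∘ ι = p then flipY else 1) 1 := by
      rw [← multiplexedU_one f]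
      exact agreeOn_multiplexedU_of_forall fun s hs => by rw [if_neg (hne s hs)]
    have h3 : AgreeOn (patternSet f 0 ι p') (applyOn place (controlled U)) 1 :=
      (agreeOn_controlled_one place U).mono fun t ht => ht.1
    have h4 := (h1.mul h3 (spanMapsTo_one _)).mul h2
      (by rw [mul_one]; exact spanMapsTo_one _)
    simpa using h4

/-- Injectivity of `pat` and absence of repetitions make at most one factor act nontrivially for a
given index, and that factor restores the flag and leaves the index alone. -/
theorem agreeOn_prod_selectOp {κ : Type} [DecidableEq κ] (ι : L → W) (pat : κ ↪ Bits L)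
    (place : (Unit ⊕ V) ↪ W) (U : κ → Op V) (hι : ∀ v i, place v ≠ ι i) (j : κ) (l : List κ)
    (hl : l.Nodup) :
    AgreeOn (patternSet (place (Sum.inl ())) 0 ι (pat j))
      (l.map fun k => selectOp ι (pat k) place (U k)).prod
      (if j ∈ l then applyOn (Function.Embedding.inr.trans place) (U j) else 1) := by
  induction l with
  | nil => simpa using AgreeOn.refl _ _
  | cons k l ih =>
    obtain ⟨hk, hl⟩ := List.nodup_cons.mp hl
    have hu : SpanMapsTo (if j ∈ l then applyOn (Function.Embedding.inr.trans place) (U j) else 1)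
        (patternSet (place (Sum.inl ())) 0 ι (pat j))
        (patternSet (place (Sum.inl ())) 0 ι (pat j)) := by
      split_ifs
      · exact spanMapsTo_applyOn _ _ (fun v h => by simpa using place.injective h)
          fun v i => hι (Sum.inr v) i
      · exact spanMapsTo_one _
    have h := (ih hl).mul (agreeOn_selectOp ι (pat k) (pat j) place (U k) hι) hu
    rw [List.map_cons, List.prod_cons]
    refine h.trans ?_
    by_cases hkj : k = j
    · subst hkj
      simpa [hk] using AgreeOn.refl _ _
    · have hkj' : pat k ≠ pat j := fun h => hkj (pat.injective h)
      simpa [hkj', Ne.symm hkj] using AgreeOn.refl _ _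

/-- The flip and its inverse cost 4 ^ r gates each; here each gate may occupy a layer of its own. -/
theorem hasCircuit_selectOp {O : Type} {L' : ℕ} (ι : Fin L' ↪ W) (p : Bits (Fin L')) {r : ℕ}
    (hr : L' ≤ 2 ^ r) (place : (Unit ⊕ V) ↪ W) (hι : ∀ v i, place v ≠ ι i) (o : O) :
    HasCircuit 1 (2 * 4 ^ r) (2 * 4 ^ r) fun U : O → Op V => selectOp ι p place (U o) := by
  obtain ⟨u, v, hz, hu, hv, hinv⟩ := exists_commutator_eq_flipY
  have h := isGateProduct_controlled hz hu hv hinv (Function.extend ι p 0)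
    (place (Sum.inl ())) r (Finset.univ.map ι) flipY
    (by simpa using fun i => (hι (Sum.inl ()) i).symm) (by simpa using hr) (IsConj.refl _)
  have hF : (fun s : Bits W => if ∀ c ∈ Finset.univ.map ι, s c = Function.extend ι p 0 c
      then flipY else 1) = fun s => if s ∘ ι = p then flipY else 1 := by
    funext s
    refine if_congr ⟨fun h => funext fun i => ?_, fun h c hc => ?_⟩ rfl rfl
    · rw [Function.comp_apply, h (ι i) (by simp), ι.injective.extend_apply]
    · obtain ⟨i, _, rfl⟩ := Finset.mem_map.mp hc
      rw [ι.injective.extend_apply, ← h]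
      rfl
  rw [hF] at h
  have := h.hasCircuit (V := V) (O := O) |>.mul
    ((hasCircuit_query o place).mul (h.star.hasCircuit (V := V) (O := O)))
  simpa only [zero_add, add_zero, two_mul, selectOp] using this

end Columns

/-! ### Block-encoding the projection onto the uniform superposition -/

section Uniform

variable {W V : Type} [Fintype W] [DecidableEq W] [Fintype V] [DecidableEq V]

theorem mul_applyOn_apply {X : Type*} (f : V ↪ W) (G : Op V) (B : Matrix X (Bits W) ℂ)
    (x : X) (t : Bits W) :
    (B * applyOn f G) x t = ∑ u, B x (Function.extend f u t) * G u (t ∘ f) := by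
  have h := applyOn_mul_apply f (star G) Bᴴ t x
  rw [applyOn_star] at h
  have h' := congrArg star h
  simpa [Matrix.mul_apply, Matrix.star_apply, mul_comm] using h'

/-- Used to compute the entries of a whole layer of gates at once. -/
theorem prod_applyOn_of_disjoint {ι : Type} (f : ι → V ↪ W) (G : ι → Op V)
    (hf : ∀ i j, i ≠ j → ∀ v v', f i v ≠ f j v') (l : List ι) (hl : l.Nodup) (s t : Bits W) :
    (l.map fun i => applyOn (f i) (G i)).prod s t =
      if ∀ w, (∀ i ∈ l, ∀ v, f i v ≠ w) → s w = t w then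
        (l.map fun i => G i (s ∘ f i) (t ∘ f i)).prod else 0 := by
  induction l generalizing s with
  | nil =>
    simp only [List.map_nil, List.prod_nil, Matrix.one_apply, List.not_mem_nil,
      IsEmpty.forall_iff, implies_true, forall_const]
    exact if_congr ⟨fun h w => congrFun h w, funext⟩ rfl rfl
  | cons i l ih =>
    obtain ⟨hi, hl⟩ := List.nodup_cons.mp hl
    have hij : ∀ j ∈ l, ∀ v v', f j v ≠ f i v' := fun j hj =>
      hf j i fun h => hi (h ▸ hj)
    rw [List.map_cons, List.prod_cons, applyOn_mul_apply, Finset.sum_eq_single (t ∘ f i)]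
    · rw [ih hl, List.map_cons, List.prod_cons]
      have hcomp : ∀ j ∈ l, Function.extend (f i) (t ∘ f i) s ∘ f j = s ∘ f j := fun j hj =>
        funext fun v => extend_off _ _ _ fun v' h => hij j hj v v' h.symm
      by_cases h : ∀ w, (∀ j ∈ i :: l, ∀ v, f j v ≠ w) → s w = t w
      · rw [if_pos h, if_pos]
        · congr 2
          exact List.map_congr_left fun j hj => by rw [hcomp j hj]
        · intro w hw
          by_cases hwf : ∃ v, f i v = w
          · obtain ⟨v, rfl⟩ := hwf
            exact (f i).injective.extend_apply _ _ v
          · have hwf' : ∀ v, f i v ≠ w := fun v hv => hwf ⟨v, hv⟩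
            rw [extend_off _ _ _ hwf']
            exact h w (List.forall_mem_cons.mpr ⟨hwf', hw⟩)
      · rw [if_neg h, if_neg, mul_zero]
        intro h'
        refine h fun w hw => ?_
        rw [← h' w fun j hj => hw j (List.mem_cons_of_mem _ hj),
          extend_off _ _ _ (hw i List.mem_cons_self)]
    · intro u _ hu
      rw [ih hl, if_neg, mul_zero]
      intro h
      refine hu (funext fun v => ?_)
      rw [Function.comp_apply, ← h (f i v) fun j hj v' => hij j hj v' v,
        (f i).injective.extend_apply]
    · simp

/-- The sign `(-1) ^ (a b)`. -/
def bitSign (a b : Fin 2) : ℂ := if a = 1 ∧ b = 1 then -1 else 1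

/-- The two-qubit unitary `SWAP (H ⊗ H)`. -/
noncomputable def swapHadamard : Matrix.unitaryGroup (Bits (Fin 2)) ℂ :=
  ⟨Matrix.of fun s t => bitSign (s 0) (t 1) * bitSign (s 1) (t 0) / 2, by
    have hconj : ∀ a b, star (bitSign a b) = bitSign a b := by
      intro a b
      unfold bitSign
      split_ifs <;> simp
    have horth : ∀ a b : Fin 2, ∑ c, bitSign a c * bitSign b c = if a = b then 2 else 0 := by
      intro a b
      fin_cases a <;> fin_cases b <;> (simp [bitSign]; try norm_num)
    rw [Matrix.mem_unitaryGroup_iff]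
    ext s t
    have hfac : ∀ r : Bits (Fin 2),
        bitSign (s 0) (r 1) * bitSign (s 1) (r 0) / 2 *
          star (bitSign (t 0) (r 1) * bitSign (t 1) (r 0) / 2) =
        (bitSign (s 1) (r 0) * bitSign (t 1) (r 0)) *
          (bitSign (s 0) (r 1) * bitSign (t 0) (r 1)) / 4 := by
      intro r
      rw [star_div₀, star_mul, hconj, hconj, star_ofNat]
      ring
    rw [Matrix.mul_apply]
    simp only [Matrix.star_apply, Matrix.of_apply, hfac]
    rw [← (finTwoArrowEquiv (Fin 2)).symm.sum_comp, Fintype.sum_prod_type]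
    simp only [finTwoArrowEquiv_symm_apply, Matrix.cons_val_zero, Matrix.cons_val_one]
    simp only [← Finset.sum_div, ← Finset.mul_sum, ← Finset.sum_mul, horth, Matrix.one_apply]
    have hst : s = t ↔ s 1 = t 1 ∧ s 0 = t 0 := by
      rw [funext_iff, Fin.forall_fin_two, and_comm]
    rw [if_congr hst rfl rfl]
    by_cases h1 : s 1 = t 1 <;> by_cases h0 : s 0 = t 0 <;> (simp [h0, h1]; try norm_num)⟩

/-- The gate `SWAP (H ⊗ H)` on the wires `c` and `t`. -/
noncomputable def Gate.swapHadamard (c t : W) (hct : c ≠ t) : Gate W where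
  arity := 2
  one_le_arity := one_le_two
  arity_le_two := le_rfl
  wires := ⟨![c, t], by
    intro i j hij
    fin_cases i <;> fin_cases j <;> simp_all [hct.symm]⟩
  op := _root_.swapHadamard

/-- The layer of gates `SWAP (H ⊗ H)` on the pairs of wires `c i`, `t i`. -/
noncomputable def swapHadamardLayer {n : ℕ} (c t : Fin n ↪ W) (hct : ∀ i j, c i ≠ t j) : Op W :=
  ((List.finRange n).map fun i => (Gate.swapHadamard (c i) (t i) (hct i i)).toOp).prod

theorem swapHadamard_wires_disjoint {n : ℕ} (c t : Fin n ↪ W) (hct : ∀ i j, c i ≠ t j)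
    {i j : Fin n} (hij : i ≠ j) (v v' : Fin 2) :
    (Gate.swapHadamard (c i) (t i) (hct i i)).wires v ≠
      (Gate.swapHadamard (c j) (t j) (hct j j)).wires v' := by
  change (![c i, t i] : Fin 2 → W) v ≠ (![c j, t j] : Fin 2 → W) v'
  have h1 := hct i j
  have h2 := (hct j i).symm
  fin_cases v <;> fin_cases v' <;> simp [hij, h1, h2]

theorem hasCircuit_swapHadamardLayer {O : Type} {n : ℕ} (c t : Fin n ↪ W)
    (hct : ∀ i j, c i ≠ t j) :
    HasCircuit 0 n 1 fun _ : O → Op V => swapHadamardLayer c t hct := by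
  have h := hasCircuit_layer (V := V) (O := O)
    ((List.finRange n).map fun i => Gate.swapHadamard (c i) (t i) (hct i i))
    (List.pairwise_map.mpr ((List.nodup_finRange n).imp fun hij =>
      swapHadamard_wires_disjoint c t hct hij))
  simpa [swapHadamardLayer, Function.comp_def] using h

theorem swapHadamardLayer_apply {n : ℕ} (c t : Fin n ↪ W) (hct : ∀ i j, c i ≠ t j)
    (s s' : Bits W) :
    swapHadamardLayer c t hct s s' =
      if ∀ w, (∀ i, c i ≠ w) → (∀ i, t i ≠ w) → s w = s' w then
        ∏ i, bitSign (s (c i)) (s' (t i)) * bitSign (s (t i)) (s' (c i)) / 2 else 0 := by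
  have h := prod_applyOn_of_disjoint
    (fun i => (Gate.swapHadamard (c i) (t i) (hct i i)).wires)
    (fun _ => (swapHadamard : Op (Fin 2)))
    (fun i j hij v v' => swapHadamard_wires_disjoint c t hct hij v v')
    (List.finRange n) (List.nodup_finRange n) s s'
  by_cases hw : ∀ w, (∀ i, c i ≠ w) → (∀ i, t i ≠ w) → s w = s' w
  · rw [if_pos hw]
    refine h.trans ((if_pos fun w hw' => hw w (fun i => hw' i (List.mem_finRange i) (0 : Fin 2))
      fun i => hw' i (List.mem_finRange i) (1 : Fin 2)).trans ?_)
    rw [← List.ofFn_eq_map, List.prod_ofFn]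
    rfl
  · rw [if_neg hw]
    refine h.trans (if_neg fun h' => hw fun w h1 h2 => h' w fun i _ v => ?_)
    change (![c i, t i] : Fin 2 → W) v ≠ w
    fin_cases v
    · exact h1 i
    · exact h2 i

end Uniform

/-! ### Linear combinations of products of block-encodings -/

section LinearCombination

/-- The projection onto the uniform superposition. -/
noncomputable def uniformProjection (n : ℕ) : Op (Fin n) := Matrix.of fun _ _ => 1 / 2 ^ n

variable {n a : ℕ} {A : Type} [Fintype A] [DecidableEq A]

theorem sum_eq_sum_elim {r : Bits A} {g : Bits (A ⊕ Fin n) → ℂ}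
    (hg : ∀ w, g w ≠ 0 → w ∘ Sum.inl = r) : ∑ w, g w = ∑ s, g (Sum.elim r s) := by
  symm
  refine Finset.sum_of_injOn (fun s => Sum.elim r s) ?_ (by simp) ?_ fun _ _ => rfl
  · intro s _ s' _ h
    exact funext fun i => congrFun h (Sum.inr i)
  · intro w _ hw
    by_contra hne
    refine hw ⟨w ∘ Sum.inr, by simp, ?_⟩
    simp only [← hg w hne]
    exact Sum.elim_comp_inl_inr w

theorem mul_mul_apply_elim {M₁ M₂ M₃ : Op (A ⊕ Fin n)} {r : Bits A}
    (h : ∀ w w' s t, M₁ (Sum.elim r s) w ≠ 0 → M₂ w w' ≠ 0 → M₃ w' (Sum.elim r t) ≠ 0 →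
      w ∘ Sum.inl = r ∧ w' ∘ Sum.inl = r) (s t : Bits (Fin n)) :
    (M₁ * (M₂ * M₃)) (Sum.elim r s) (Sum.elim r t) =
      ∑ s', M₁ (Sum.elim r s) (Sum.elim r s') *
        ∑ t', M₂ (Sum.elim r s') (Sum.elim r t') * M₃ (Sum.elim r t') (Sum.elim r t) := by
  rw [Matrix.mul_apply, sum_eq_sum_elim (r := r)]
  · refine Finset.sum_congr rfl fun s' _ => ?_
    by_cases h1 : M₁ (Sum.elim r s) (Sum.elim r s') = 0
    · rw [h1, zero_mul, zero_mul]
    · rw [Matrix.mul_apply, sum_eq_sum_elim (r := r)]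
      intro w hw
      exact (h _ _ _ _ h1 (left_ne_zero_of_mul hw) (right_ne_zero_of_mul hw)).2
  · intro w hw
    have h2 := right_ne_zero_of_mul hw
    rw [Matrix.mul_apply] at h2
    obtain ⟨w', _, hw'⟩ := Finset.exists_ne_zero_of_sum_ne_zero h2
    exact (h _ _ _ _ (left_ne_zero_of_mul hw) (left_ne_zero_of_mul hw')
      (right_ne_zero_of_mul hw')).1

/-- The wires of a controlled black box with control `f` and ancillas `x`. -/
def blackBoxWires (f : A) (x : Fin a ↪ A) (hx : ∀ i, x i ≠ f) :
    Unit ⊕ (Fin a ⊕ Fin n) ↪ A ⊕ Fin n where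
  toFun := Sum.elim (fun _ => Sum.inl f) (Sum.elim (fun i => Sum.inl (x i)) Sum.inr)
  inj' := by
    rintro (_ | i | i) (_ | j | j) h <;> simp_all [eq_comm]

theorem applyOn_blackBoxWires_elim (f : A) (x : Fin a ↪ A) (hx : ∀ i, x i ≠ f)
    (U : Op (Fin a ⊕ Fin n)) {r : Bits A} (hr : ∀ i, r (x i) = 0) (s t : Bits (Fin n)) :
    applyOn (Function.Embedding.inr.trans (blackBoxWires f x hx)) U (Sum.elim r s)
      (Sum.elim r t) = zeroBlock U s t := by
  have hcomp : ∀ s : Bits (Fin n), (Sum.elim r s : Bits (A ⊕ Fin n)) ∘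
      (Function.Embedding.inr.trans (blackBoxWires f x hx)) = Sum.elim (fun _ => 0) s := by
    intro s
    funext v
    rcases v with i | i
    · exact hr i
    · rfl
  rw [applyOn_apply, hcomp, hcomp, if_pos]
  · rfl
  · rintro (w | i) hw
    · rfl
    · exact absurd rfl (hw (Sum.inr i))

theorem applyOn_blackBoxWires_support {f : A} {x : Fin a ↪ A} {hx : ∀ i, x i ≠ f}
    {U : Op (Fin a ⊕ Fin n)} {s t : Bits (A ⊕ Fin n)}
    (h : applyOn (Function.Embedding.inr.trans (blackBoxWires f x hx)) U s t ≠ 0) {w : A}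
    (hw : ∀ i, x i ≠ w) : s (Sum.inl w) = t (Sum.inl w) := by
  refine applyOn_support h ?_
  rintro (i | i) h'
  · exact hw i (Sum.inl_injective h')
  · exact Sum.inr_ne_inl h'

/-- In general the corner of a product is not the product of the corners. Here each ancilla register
is touched by only one of the three factors, so ancillas that start and end in `r` are in `r` at
both intermediate times as well. -/
theorem blackBox_layer_blackBox_apply (f : A) (x y : Fin a ↪ A) (c : Fin n ↪ A)
    (hx : ∀ i, x i ≠ f) (hy : ∀ i, y i ≠ f) (hxy : ∀ i j, x i ≠ y j) (hxc : ∀ i j, x i ≠ c j)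
    (hyc : ∀ i j, y i ≠ c j)
    (hc : ∀ i j, (c.trans Function.Embedding.inl : Fin n ↪ A ⊕ Fin n) i ≠
      (Function.Embedding.inr : Fin n ↪ A ⊕ Fin n) j)
    (UX UY : Op (Fin a ⊕ Fin n)) {r : Bits A} (hrx : ∀ i, r (x i) = 0) (hry : ∀ i, r (y i) = 0)
    (hrc : ∀ i, r (c i) = 0) (s t : Bits (Fin n)) :
    (applyOn (Function.Embedding.inr.trans (blackBoxWires f x hx)) UX *
      (swapHadamardLayer (c.trans Function.Embedding.inl) Function.Embedding.inr hc *
        applyOn (Function.Embedding.inr.trans (blackBoxWires f y hy)) UY))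
      (Sum.elim r s) (Sum.elim r t) =
      (zeroBlock UX * (uniformProjection n * zeroBlock UY)) s t := by
  have hJ : ∀ {w w' : Bits (A ⊕ Fin n)}, swapHadamardLayer (c.trans Function.Embedding.inl)
      Function.Embedding.inr hc w w' ≠ 0 → ∀ v : A, (∀ i, c i ≠ v) →
        w (Sum.inl v) = w' (Sum.inl v) := by
    intro w w' h v hv
    rw [swapHadamardLayer_apply] at h
    by_contra hne
    exact h (if_neg fun h' => hne (h' _ (fun i hi => hv i (Sum.inl_injective hi)) fun i hi =>
      Sum.inr_ne_inl hi))
  rw [mul_mul_apply_elim]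
  · rw [Matrix.mul_apply]
    refine Finset.sum_congr rfl fun s' _ => ?_
    rw [applyOn_blackBoxWires_elim f x hx UX hrx, Matrix.mul_apply]
    congr 1
    refine Finset.sum_congr rfl fun t' _ => ?_
    rw [applyOn_blackBoxWires_elim f y hy UY hry]
    congr 1
    rw [swapHadamardLayer_apply, if_pos]
    -- With the paired ancillas in 0 on both sides all signs are 1, and each of the n pairs
    -- contributes a factor 1/2.
    · simp [bitSign, hrc, uniformProjection]
    · rintro (w | i) _ hw
      · rfl
      · exact absurd rfl (hw i)
  · intro w w' s t h1 h2 h3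
    have hX : ∀ v, (∀ i, x i ≠ v) → w (Sum.inl v) = r v := fun v hv =>
      (applyOn_blackBoxWires_support h1 hv).symm
    have hY : ∀ v, (∀ i, y i ≠ v) → w' (Sum.inl v) = r v := fun v hv =>
      applyOn_blackBoxWires_support h3 hv
    constructor
    · funext v
      by_cases hv : ∃ i, x i = v
      · obtain ⟨i, rfl⟩ := hv
        exact (hJ h2 _ fun j => (hxc i j).symm).trans (hY _ fun j => (hxy i j).symm)
      · exact hX v fun i hi => hv ⟨i, hi⟩
    · funext v
      by_cases hv : ∃ i, y i = v
      · obtain ⟨i, rfl⟩ := hv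
        exact (hJ h2 _ fun j => (hyc i j).symm).symm.trans (hX _ fun j => hxy j i)
      · exact hY v fun i hi => hv ⟨i, hi⟩

end LinearCombination

/-! ### The preparation, selection and rotation circuit -/

section LinearCombinationCircuit

variable {n a : ℕ} {A : Type} [Fintype A] [DecidableEq A]

theorem extend_elim {L : ℕ} (ι : Fin L ↪ A) (u : Bits (Fin L)) (r : Bits A) (s : Bits (Fin n)) :
    Function.extend (ι.trans Function.Embedding.inl : Fin L ↪ A ⊕ Fin n) u (Sum.elim r s) =
      Sum.elim (Function.extend ι u r) s := by
  funext w
  rcases w with w | w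
  · by_cases hw : ∃ i, ι i = w
    · obtain ⟨i, rfl⟩ := hw
      rw [Sum.elim_inl, ι.injective.extend_apply]
      exact (ι.trans Function.Embedding.inl).injective.extend_apply _ _ i
    · rw [Sum.elim_inl, extend_off _ _ _ fun i hi => hw ⟨i, hi⟩, extend_off]
      · rfl
      · exact fun i hi => hw ⟨i, Sum.inl_injective hi⟩
  · rw [extend_off]
    · rfl
    · exact fun i hi => Sum.inl_ne_inr hi

/-- If `M` preserves the flag and the index register and the index register is prepared with
amplitudes `α` on both sides of `M` and of a rotation of the flag, then the corner of the product
is a weighted sum of the diagonal blocks of `M`. -/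
theorem preparation_rotation_apply {L : ℕ} (ι : Fin L ↪ A) (f : A) (hf : ∀ i, ι i ≠ f)
    (P : Op (Fin L)) (α : Bits (Fin L) → ℝ) (hP : ∀ u, P u 0 = α u) (θ : ℝ)
    (M : Op (A ⊕ Fin n))
    (hM : ∀ u, α u ≠ 0 → SpanMapsTo M
      (patternSet (Sum.inl f) 0 (ι.trans Function.Embedding.inl : Fin L ↪ A ⊕ Fin n) u)
      (patternSet (Sum.inl f) 0 (ι.trans Function.Embedding.inl : Fin L ↪ A ⊕ Fin n) u))
    (s t : Bits (Fin n)) :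
    ((star (applyOn (ι.trans Function.Embedding.inl) P) *
      (multiplexedU (Sum.inl f) (fun _ => rotY θ) *
        (M * applyOn (ι.trans Function.Embedding.inl) P)) : Op (A ⊕ Fin n))) (Sum.elim 0 s) (Sum.elim 0 t) =
      ∑ u, (Real.cos θ : ℂ) * (α u : ℂ) ^ 2 *
        M (Sum.elim (Function.extend ι u 0) s) (Sum.elim (Function.extend ι u 0) t) := by
  have hzero : ∀ s : Bits (Fin n), (Sum.elim 0 s : Bits (A ⊕ Fin n)) ∘
      (ι.trans Function.Embedding.inl : Fin L ↪ A ⊕ Fin n) = 0 := fun s => rfl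
  have hmem : ∀ (u : Bits (Fin L)) (t : Bits (Fin n)),
      (Sum.elim (Function.extend ι u 0) t : Bits (A ⊕ Fin n)) ∈
        patternSet (Sum.inl f) 0 (ι.trans Function.Embedding.inl : Fin L ↪ A ⊕ Fin n) u :=
    fun u t => ⟨extend_off ι u 0 hf, extend_comp_emb ι u 0⟩
  rw [← applyOn_star, applyOn_mul_apply]
  refine Finset.sum_congr rfl fun u _ => ?_
  rw [hzero, extend_elim, Matrix.star_apply, hP,
    multiplexedU, multiplexed_mul_apply _ _ fun _ _ _ => rfl, Fin.sum_univ_two, mul_applyOn_apply,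
    mul_applyOn_apply, hzero]
  simp only [extend_elim, hP]
  have hflag : (Sum.elim (Function.extend ι u 0) s : Bits (A ⊕ Fin n)) (Sum.inl f) = 0 :=
    (hmem u s).1
  have hupd : Function.update (Sum.elim (Function.extend ι u 0) s : Bits (A ⊕ Fin n))
      (Sum.inl f) 0 = Sum.elim (Function.extend ι u 0) s := by
    rw [← hflag, Function.update_eq_self]
  -- The sine part of the rotation would require `M` to turn flag 0 into flag 1, which it never
  -- does; only the cosine survives.
  have h1 : ∑ u', M (Function.update (Sum.elim (Function.extend ι u 0) s : Bits (A ⊕ Fin n))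
      (Sum.inl f) 1) (Sum.elim (Function.extend ι u' 0) t) * (α u' : ℂ) = 0 := by
    refine Finset.sum_eq_zero fun u' _ => ?_
    by_contra h
    have hα : α u' ≠ 0 := by exact_mod_cast right_ne_zero_of_mul h
    have := (hM u' hα _ _ (hmem u' t) (left_ne_zero_of_mul h)).1
    simp at this
  -- `M` preserves the index, so the double sum over indices reduces to its diagonal and the
  -- amplitude appears squared.
  have h0 : ∑ u', M (Sum.elim (Function.extend ι u 0) s) (Sum.elim (Function.extend ι u' 0) t) *
      (α u' : ℂ) = M (Sum.elim (Function.extend ι u 0) s)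
        (Sum.elim (Function.extend ι u 0) t) * (α u : ℂ) := by
    refine Finset.sum_eq_single u (fun u' _ hu' => ?_) (by simp)
    by_contra h
    have hα : α u' ≠ 0 := by exact_mod_cast right_ne_zero_of_mul h
    exact hu' ((hM u' hα _ _ (hmem u' t) (left_ne_zero_of_mul h)).2.symm.trans (hmem u s).2)
  rw [h1, mul_zero, add_zero, hupd, h0, hflag]
  simp only [rotY, Matrix.of_apply, Matrix.cons_val', Matrix.cons_val_zero, Complex.star_def,
    Complex.conj_ofReal]
  ring

/-- The quantum circuit for a linear combination of the operators `X_k |+⟩⟨+| Y_k`, in which `X_k`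
and `Y_k` are given by block-encodings. -/
theorem exists_linearCombination_circuit {L m r : ℕ} {κ : Type} [Fintype κ] [DecidableEq κ]
    (e : Fin n ⊕ Unit ⊕ Fin a ⊕ Fin a ⊕ Fin L ↪ Fin m) (pat : κ ↪ Bits (Fin L)) (hr : L ≤ 2 ^ r)
    (w : κ → ℝ) (hw : ∀ k, 0 ≤ w k) (hpos : 0 < ∑ k, w k) {α : ℝ} (hα : ∑ k, w k ≤ α) :
    ∃ c : Circuit (Fin m ⊕ Fin n) (Fin a ⊕ Fin n) (κ ⊕ κ),
      c.queries ≤ 2 * Fintype.card κ ∧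
      c.size ≤ 6 * 2 ^ L + 4 * (Fintype.card κ * 4 ^ r) + n + 1 ∧
      c.depth ≤ 6 * 2 ^ L + 4 * (Fintype.card κ * 4 ^ r) + 2 ∧
      ∀ UX UY : κ → Op (Fin a ⊕ Fin n),
        (α : ℂ) • zeroBlock (Circuit.eval (Sum.elim UX UY) c) =
          ∑ k, (w k : ℂ) • (zeroBlock (UX k) * (uniformProjection n * zeroBlock (UY k))) := by
  let anc : Fin n ↪ Fin m := Function.Embedding.inl.trans e
  let f : Fin m := e (Sum.inr (Sum.inl ()))
  let x : Fin a ↪ Fin m := ⟨fun i => e (Sum.inr (Sum.inr (Sum.inl i))), fun i j h => by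
    simpa using h⟩
  let y : Fin a ↪ Fin m := ⟨fun i => e (Sum.inr (Sum.inr (Sum.inr (Sum.inl i)))), fun i j h => by
    simpa using h⟩
  let ι : Fin L ↪ Fin m := ⟨fun i => e (Sum.inr (Sum.inr (Sum.inr (Sum.inr i)))), fun i j h => by
    simpa using h⟩
  have hxf : ∀ i, x i ≠ f := fun i h => by simpa using e.injective h
  have hyf : ∀ i, y i ≠ f := fun i h => by simpa using e.injective h
  have hxy : ∀ i j, x i ≠ y j := fun i j h => by simpa using e.injective h
  have hxc : ∀ i j, x i ≠ anc j := fun i j h => by simpa using e.injective h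
  have hyc : ∀ i j, y i ≠ anc j := fun i j h => by simpa using e.injective h
  have hιx : ∀ i j, ι i ≠ x j := fun i j h => by simpa using e.injective h
  have hιy : ∀ i j, ι i ≠ y j := fun i j h => by simpa using e.injective h
  have hιc : ∀ i j, ι i ≠ anc j := fun i j h => by simpa using e.injective h
  have hιf : ∀ i, ι i ≠ f := fun i h => by simpa using e.injective h
  have hfc : ∀ i, anc i ≠ f := fun i h => by simpa using e.injective h
  clear_value anc f x y ι
  let ιW : Fin L ↪ Fin m ⊕ Fin n := ι.trans Function.Embedding.inl
  have hanc : ∀ i j, (anc.trans Function.Embedding.inl : Fin n ↪ Fin m ⊕ Fin n) i ≠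
      (Function.Embedding.inr : Fin n ↪ Fin m ⊕ Fin n) j := fun i j => Sum.inl_ne_inr
  have hplace : ∀ (z : Fin a ↪ Fin m) (hz : ∀ i, z i ≠ f), (∀ i j, ι i ≠ z j) →
      ∀ v i, (blackBoxWires f z hz : _ ↪ Fin m ⊕ Fin n) v ≠ ιW i := by
    rintro z hz hιz (_ | i | i) j h
    · exact hιf j (Sum.inl_injective h).symm
    · exact hιz j i (Sum.inl_injective h).symm
    · exact Sum.inr_ne_inl h
  -- the amplitudes
  set σ := ∑ k, w k with hσ
  have hαpos : 0 < α := hpos.trans_le hα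
  -- Bit patterns that label no term get amplitude 0, so the action of the circuit on them is
  -- irrelevant.
  let amp : Bits (Fin L) → ℝ := Function.extend pat (fun k => √(w k / σ)) 0
  have hamp : ∀ k, amp (pat k) = √(w k / σ) := fun k => pat.injective.extend_apply _ _ k
  have hamp0 : ∀ u, amp u ≠ 0 → ∃ k, pat k = u := fun u hu => by
    by_contra h
    exact hu (Function.extend_apply' _ _ _ h)
  have hsum : ∀ B : Bits (Fin L) → ℂ,
      ∑ u, (amp u : ℂ) ^ 2 * B u = ∑ k, ((w k / σ : ℝ) : ℂ) * B (pat k) := by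
    intro B
    symm
    refine Finset.sum_of_injOn pat pat.injective.injOn (by simp) (fun u _ hu => ?_) fun k _ => ?_
    · have : amp u = 0 := by
        by_contra h
        obtain ⟨k, hk⟩ := hamp0 u h
        exact hu ⟨k, by simp, hk⟩
      simp [this]
    · rw [hamp, ← Complex.ofReal_pow, Real.sq_sqrt (div_nonneg (hw k) hpos.le)]
  obtain ⟨P, hP, hPa⟩ := exists_statePreparation L amp
    (fun u => by
      by_cases h : amp u = 0
      · exact h.ge
      · obtain ⟨k, rfl⟩ := hamp0 u h
        rw [hamp]
        exact Real.sqrt_nonneg _)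
    (by
      have h := hsum fun _ => 1
      simp only [mul_one] at h
      have h' : ∑ u, amp u ^ 2 = ∑ k, w k / σ := by exact_mod_cast h
      rw [h', ← Finset.sum_div, div_self hpos.ne'])
  have hPW := hP.applyOn ιW
  -- The corner of the prepared circuit carries the factor 1/σ; multiplying it by cos θ = σ/α turns
  -- this into 1/α.
  let θ := Real.arccos (σ / α)
  have hθ : Real.cos θ = σ / α := Real.cos_arccos
    (by linarith [div_pos hpos hαpos]) ((div_le_one hαpos).mpr hα)
  -- the circuit
  let S : (z : Fin a ↪ Fin m) → (∀ i, z i ≠ f) → (κ → Op (Fin a ⊕ Fin n)) → Op (Fin m ⊕ Fin n) :=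
    fun z hz U => (Finset.univ.toList.map fun k =>
      selectOp ιW (pat k) (blackBoxWires f z hz) (U k)).prod
  have hSX : HasCircuit _ _ _ fun U : κ ⊕ κ → Op (Fin a ⊕ Fin n) =>
      S x hxf fun k => U (Sum.inl k) :=
    HasCircuit.list_prod Finset.univ.toList fun k =>
      hasCircuit_selectOp ιW (pat k) hr (blackBoxWires f x hxf) (hplace x hxf hιx) (Sum.inl k)
  have hSY : HasCircuit _ _ _ fun U : κ ⊕ κ → Op (Fin a ⊕ Fin n) =>
      S y hyf fun k => U (Sum.inr k) :=
    HasCircuit.list_prod Finset.univ.toList fun k =>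
      hasCircuit_selectOp ιW (pat k) hr (blackBoxWires f y hyf) (hplace y hyf hιy) (Sum.inr k)
  have hR := (Gate.single (Sum.inl f : Fin m ⊕ Fin n) (rotY θ)).isGateProduct
  rw [Gate.toOp_single] at hR
  -- Two state preparations give 6 · 2^L, the two selections 4 · card κ · 4^r, the swap layer n
  -- gates of depth 1, and the rotation one gate.
  obtain ⟨c, hq, hs, hd, hc⟩ := hPW.star.hasCircuit.mul (hR.hasCircuit.mul
    ((hSX.mul ((hasCircuit_swapHadamardLayer (anc.trans Function.Embedding.inl)
      Function.Embedding.inr hanc).mul hSY)).mul hPW.hasCircuit))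
  rw [Finset.length_toList, Finset.card_univ] at hq hs hd
  refine ⟨c, hq.trans (by omega), hs.trans (by nlinarith), hd.trans (by nlinarith),
    fun UX UY => ?_⟩
  have hagree : ∀ (z : Fin a ↪ Fin m) (hz : ∀ i, z i ≠ f), (∀ i j, ι i ≠ z j) →
      ∀ (U : κ → Op (Fin a ⊕ Fin n)) (k : κ), AgreeOn (patternSet (Sum.inl f) 0 ιW (pat k))
        (S z hz U) (applyOn (Function.Embedding.inr.trans (blackBoxWires f z hz)) (U k)) := by
    intro z hz hιz U k
    have := agreeOn_prod_selectOp ιW pat (blackBoxWires f z hz) U (hplace z hz hιz) k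
      Finset.univ.toList (Finset.nodup_toList _)
    rw [if_pos (by simp)] at this
    exact this
  have hmaps : ∀ (z : Fin a ↪ Fin m) (hz : ∀ i, z i ≠ f), (∀ i j, ι i ≠ z j) →
      ∀ (U : Op (Fin a ⊕ Fin n)) (u : Bits (Fin L)),
        SpanMapsTo (applyOn (Function.Embedding.inr.trans (blackBoxWires f z hz)) U)
          (patternSet (Sum.inl f) 0 ιW u) (patternSet (Sum.inl f) 0 ιW u) := by
    intro z hz hιz U u
    refine spanMapsTo_applyOn _ _ ?_ fun v i => hplace z hz hιz (Sum.inr v) i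
    rintro (i | i) h
    · exact hz i (Sum.inl_injective h)
    · exact Sum.inr_ne_inl h
  have hJ : ∀ u : Bits (Fin L), SpanMapsTo (swapHadamardLayer
      (anc.trans Function.Embedding.inl : Fin n ↪ Fin m ⊕ Fin n) Function.Embedding.inr hanc)
      (patternSet (Sum.inl f) 0 ιW u) (patternSet (Sum.inl f) 0 ιW u) := by
    intro u s t ht h
    rw [swapHadamardLayer_apply] at h
    have h' : ∀ v : Fin m, (∀ i, anc i ≠ v) → s (Sum.inl v) = t (Sum.inl v) := by
      intro v hv
      by_contra hne
      exact h (if_neg fun h' => hne (h' _ (fun i hi => hv i (Sum.inl_injective hi)) fun i hi =>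
        Sum.inr_ne_inl hi))
    refine ⟨(h' f hfc).trans ht.1, ?_⟩
    rw [← ht.2]
    exact funext fun i => h' (ι i) fun j => (hιc i j).symm
  -- On flag 0 and index k, the selections on both sides of the swap layer become the uncontrolled
  -- black boxes with label k.
  have hmid : ∀ k, AgreeOn (patternSet (Sum.inl f) 0 ιW (pat k)) _ _ := fun k =>
    ((hagree y hyf hιy UY k).mul (AgreeOn.refl _ _) (hmaps y hyf hιy (UY k) (pat k))).mul
      (hagree x hxf hιx UX k) ((hmaps y hyf hιy (UY k) (pat k)).mul (hJ (pat k)))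
  ext s t
  have hentry := preparation_rotation_apply ι f hιf P amp hPa θ
    (S x hxf UX * (swapHadamardLayer (anc.trans Function.Embedding.inl) Function.Embedding.inr
      hanc * S y hyf UY)) (by
      intro u hu
      obtain ⟨k, rfl⟩ := hamp0 u hu
      intro s t ht h
      rw [hmid k s t ht] at h
      exact (((hmaps y hyf hιy (UY k) (pat k)).mul (hJ (pat k))).mul
        (hmaps x hxf hιx (UX k) (pat k))) s t ht h) s t
  have hzb : zeroBlock (Circuit.eval (Sum.elim UX UY) c) s t =
      Circuit.eval (Sum.elim UX UY) c (Sum.elim 0 s) (Sum.elim 0 t) := rfl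
  rw [Matrix.smul_apply, hzb, hc]
  refine (congrArg (fun z => (α : ℂ) • z) hentry).trans ?_
  simp only [mul_assoc]
  rw [← Finset.mul_sum, hsum, Matrix.sum_apply, hθ, smul_eq_mul, Finset.mul_sum, Finset.mul_sum]
  refine Finset.sum_congr rfl fun k _ => ?_
  have hoff : ∀ v, (∀ i, ι i ≠ v) → Function.extend ι (pat k) 0 v = 0 := fun v hv =>
    extend_off ι _ _ hv
  rw [hmid k _ _ ⟨hoff f hιf, extend_comp_emb ι (pat k) 0⟩,
    blackBox_layer_blackBox_apply f x y anc hxf hyf hxy hxc hyc hanc (UX k) (UY k)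
      (fun i => hoff _ fun j => hιx j i) (fun i => hoff _ fun j => hιy j i)
      (fun i => hoff _ fun j => hιc j i), Matrix.smul_apply, smul_eq_mul, ← mul_assoc, ← mul_assoc]
  congr 1
  have h1 : (α : ℂ) ≠ 0 := by exact_mod_cast hαpos.ne'
  have h2 : (σ : ℂ) ≠ 0 := by exact_mod_cast hpos.ne'
  push_cast
  field_simp

end LinearCombinationCircuit

/-! ### Spectral norms -/

section Norms

variable {n a : ℕ}

theorem norm_one_op_le {W : Type} [Fintype W] [DecidableEq W] : ‖(1 : Op W)‖ ≤ 1 :=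
  CStarRing.norm_one.le

/-- The corner is the compression E† U E of a unitary by the isometry E that adjoins zero ancillas.
-/
theorem norm_zeroBlock_le_one {U : Op (Fin a ⊕ Fin n)}
    (hU : U ∈ Matrix.unitaryGroup (Bits (Fin a ⊕ Fin n)) ℂ) : ‖zeroBlock U‖ ≤ 1 := by
  let E : Matrix (Bits (Fin a ⊕ Fin n)) (Bits (Fin n)) ℂ :=
    (1 : Op (Fin a ⊕ Fin n)).submatrix id (Sum.elim fun _ => 0)
  have hinj : Function.Injective (Sum.elim (fun _ => 0) : Bits (Fin n) → Bits (Fin a ⊕ Fin n)) :=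
    fun s t h => funext fun i => congrFun h (Sum.inr i)
  have hEE : Eᴴ * E = 1 := by
    simp only [E, Matrix.conjTranspose_submatrix, Matrix.conjTranspose_one]
    rw [← Matrix.submatrix_mul _ _ _ _ _ Function.bijective_id, mul_one,
      Matrix.submatrix_one _ hinj]
  have hE : ‖E‖ ≤ 1 := by
    have h := Matrix.l2_opNorm_conjTranspose_mul_self E
    rw [hEE] at h
    have h1 : ‖(1 : Op (Fin n))‖ ≤ 1 := norm_one_op_le
    nlinarith [norm_nonneg E]
  have hz : zeroBlock U = Eᴴ * (U * E) := by
    have h1 : U * E = U.submatrix id (Sum.elim fun _ => 0) := by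
      have := Matrix.submatrix_mul U (1 : Op (Fin a ⊕ Fin n)) id id
        (Sum.elim (fun _ => 0) : Bits (Fin n) → Bits (Fin a ⊕ Fin n)) Function.bijective_id
      rw [mul_one] at this
      exact this.symm
    rw [h1]
    simp only [E, Matrix.conjTranspose_submatrix, Matrix.conjTranspose_one]
    rw [← Matrix.submatrix_mul _ _ _ _ _ Function.bijective_id, one_mul]
    rfl
  have hUn : ‖U‖ = 1 := CStarRing.norm_of_mem_unitary hU
  have hEH : ‖Eᴴ‖ = ‖E‖ := Matrix.l2_opNorm_conjTranspose E
  rw [hz]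
  calc ‖Eᴴ * (U * E)‖ ≤ ‖Eᴴ‖ * ‖U * E‖ := Matrix.l2_opNorm_mul _ _
    _ ≤ ‖Eᴴ‖ * (‖U‖ * ‖E‖) := by gcongr; exact Matrix.l2_opNorm_mul _ _
    _ ≤ 1 * (1 * 1) := by rw [hEH, hUn]; gcongr
    _ = 1 := by norm_num

/-- A matrix with entries of modulus at most `η / N` has spectral norm at most `η`. -/
theorem norm_le_of_entries {M : Op (Fin n)} {η : ℝ} (hη : 0 ≤ η)
    (h : ∀ s t, ‖M s t‖ ≤ η / 2 ^ n) : ‖M‖ ≤ η := by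
  rw [Matrix.l2_opNorm_def]
  refine ContinuousLinearMap.opNorm_le_bound _ hη fun v => ?_
  have hcard : (Fintype.card (Bits (Fin n)) : ℝ) = 2 ^ n := by simp
  -- Cauchy–Schwarz; its factor N and the N rows together cancel the square of the 1/N in the
  -- entries.
  have hsum : (∑ t, ‖v t‖) ^ 2 ≤ 2 ^ n * ‖v‖ ^ 2 := by
    rw [EuclideanSpace.norm_sq_eq, ← hcard]
    simpa using sq_sum_le_card_mul_sum_sq (s := Finset.univ) (f := fun t => ‖v t‖)
  have hrow : ∀ s, ‖(M *ᵥ v.ofLp) s‖ ≤ η / 2 ^ n * ∑ t, ‖v t‖ := by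
    intro s
    rw [Matrix.mulVec, dotProduct, Finset.mul_sum]
    refine (norm_sum_le _ _).trans (Finset.sum_le_sum fun t _ => ?_)
    rw [norm_mul]
    gcongr
    exact h s t
  refine le_of_sq_le_sq ?_ (by positivity)
  change ‖WithLp.toLp 2 (M *ᵥ v.ofLp)‖ ^ 2 ≤ _
  rw [EuclideanSpace.norm_sq_eq]
  calc ∑ s, ‖(M *ᵥ v.ofLp) s‖ ^ 2 ≤ ∑ _s : Bits (Fin n), (η / 2 ^ n * ∑ t, ‖v t‖) ^ 2 := by
        gcongr with s
        exact hrow s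
    _ = η ^ 2 / 2 ^ n * (∑ t, ‖v t‖) ^ 2 := by
        rw [Finset.sum_const, Finset.card_univ, nsmul_eq_mul, hcard]
        field_simp
    _ ≤ η ^ 2 / 2 ^ n * (2 ^ n * ‖v‖ ^ 2) := by gcongr
    _ = (η * ‖v‖) ^ 2 := by field_simp

theorem norm_uniformProjection_le_one : ‖uniformProjection n‖ ≤ 1 :=
  norm_le_of_entries zero_le_one fun s t => by simp [uniformProjection]

/-- Replace one factor at a time. The exact factor Y is only known to satisfy ‖Y‖ ≤ 1 + δ ≤ 2, so
the two errors are 2δ and δ. -/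
theorem norm_mul_mul_sub_le {W : Type} [Fintype W] [DecidableEq W] {X Y X' Y' J : Op W} {δ : ℝ}
    (hδ : δ ≤ 1) (hX' : ‖X'‖ ≤ 1) (hY' : ‖Y'‖ ≤ 1) (hJ : ‖J‖ ≤ 1) (hX : ‖X - X'‖ ≤ δ)
    (hY : ‖Y - Y'‖ ≤ δ) : ‖X * (J * Y) - X' * (J * Y')‖ ≤ 3 * δ := by
  have hδ0 : 0 ≤ δ := (norm_nonneg _).trans hX
  have hYn : ‖Y‖ ≤ 2 := by
    calc ‖Y‖ = ‖(Y - Y') + Y'‖ := by rw [sub_add_cancel]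
      _ ≤ ‖Y - Y'‖ + ‖Y'‖ := norm_add_le _ _
      _ ≤ 2 := by linarith
  have h : X * (J * Y) - X' * (J * Y') = (X - X') * (J * Y) + X' * (J * (Y - Y')) := by
    noncomm_ring
  rw [h]
  calc _ ≤ ‖(X - X') * (J * Y)‖ + ‖X' * (J * (Y - Y'))‖ := norm_add_le _ _
    _ ≤ ‖X - X'‖ * (‖J‖ * ‖Y‖) + ‖X'‖ * (‖J‖ * ‖Y - Y'‖) := by
        gcongr
        · exact (norm_mul_le _ _).trans (by gcongr; exact norm_mul_le _ _)
        · exact (norm_mul_le _ _).trans (by gcongr; exact norm_mul_le _ _)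
    _ ≤ δ * (1 * 2) + 1 * (1 * δ) := by gcongr
    _ = 3 * δ := by ring

theorem diagOp_uniformProjection_diagOp_apply (d d' : Fin (2 ^ n) → ℂ) (s t : Bits (Fin n)) :
    (diagOp d * (uniformProjection n * diagOp d')) s t =
      d (basisIndex s) * d' (basisIndex t) / 2 ^ n := by
  rw [diagOp, diagOp, Matrix.diagonal_mul, Matrix.mul_diagonal]
  simp only [uniformProjection, Matrix.of_apply]
  ring

/-- A block-encoding of the quantum Laplace transform from an approximate expansion of its
kernel. -/
theorem exists_blockEncoding_QLT {L m r : ℕ} {κ : Type} [Fintype κ] [DecidableEq κ]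
    (e : Fin n ⊕ Unit ⊕ Fin a ⊕ Fin a ⊕ Fin L ↪ Fin m) (pat : κ ↪ Bits (Fin L)) (hr : L ≤ 2 ^ r)
    (w : κ → ℝ) (hw : ∀ k, 0 ≤ w k) (hpos : 0 < ∑ k, w k) {α : ℝ} (hα : ∑ k, w k ≤ α)
    (hα1 : 1 ≤ α) {ε : ℝ} (hε : 0 < ε) (hε1 : ε < 1) (x y : Fin (2 ^ n) → ℂ)
    (dx dy : κ → Fin (2 ^ n) → ℂ)
    (hd : ∀ i j, ‖Complex.exp (x i * y j) - ∑ k, (w k : ℂ) * (dx k i * dy k j)‖ ≤ ε / 2) :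
    ∃ c : Circuit (Fin m ⊕ Fin n) (Fin a ⊕ Fin n) (κ ⊕ κ),
      c.queries ≤ 2 * Fintype.card κ ∧
      c.size ≤ 6 * 2 ^ L + 4 * (Fintype.card κ * 4 ^ r) + n + 1 ∧
      c.depth ≤ 6 * 2 ^ L + 4 * (Fintype.card κ * 4 ^ r) + 2 ∧
      ∀ UX UY : κ → Op (Fin a ⊕ Fin n),
        (∀ k, IsBlockEncoding 1 (ε / (6 * α)) (UX k) (diagOp (dx k))) →
        (∀ k, IsBlockEncoding 1 (ε / (6 * α)) (UY k) (diagOp (dy k))) →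
        IsBlockEncoding α ε (Circuit.eval (Sum.elim UX UY) c) (QLT x y) := by
  obtain ⟨c, h1, h2, h3, h4⟩ := exists_linearCombination_circuit e pat hr w hw hpos hα
  refine ⟨c, h1, h2, h3, fun UX UY hX hY => ⟨Circuit.eval_mem_unitaryGroup (by
    rintro (k | k)
    · exact (hX k).1
    · exact (hY k).1) c, ?_⟩⟩
  rw [h4]
  set δ := ε / (6 * α) with hδ
  have hα0 : 0 < α := by linarith
  have hδ0 : 0 < δ := by positivity
  have hδ1 : δ ≤ 1 := by
    rw [hδ, div_le_one (by positivity)]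
    linarith
  have hterm : ∀ k, ‖diagOp (dx k) * (uniformProjection n * diagOp (dy k)) -
      zeroBlock (UX k) * (uniformProjection n * zeroBlock (UY k))‖ ≤ 3 * δ := fun k =>
    norm_mul_mul_sub_le hδ1 (norm_zeroBlock_le_one (hX k).1) (norm_zeroBlock_le_one (hY k).1)
      norm_uniformProjection_le_one (by simpa using (hX k).2) (by simpa using (hY k).2)
  have hsplit : QLT x y -
      ∑ k, (w k : ℂ) • (zeroBlock (UX k) * (uniformProjection n * zeroBlock (UY k))) =
      (QLT x y - ∑ k, (w k : ℂ) • (diagOp (dx k) * (uniformProjection n * diagOp (dy k)))) +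
      ∑ k, (w k : ℂ) • (diagOp (dx k) * (uniformProjection n * diagOp (dy k)) -
        zeroBlock (UX k) * (uniformProjection n * zeroBlock (UY k))) := by
    simp only [smul_sub, Finset.sum_sub_distrib]
    abel
  have hfirst : ‖QLT x y -
      ∑ k, (w k : ℂ) • (diagOp (dx k) * (uniformProjection n * diagOp (dy k)))‖ ≤ ε / 2 := by
    refine norm_le_of_entries (by positivity) fun s t => ?_
    have hentry : (QLT x y -
        ∑ k, (w k : ℂ) • (diagOp (dx k) * (uniformProjection n * diagOp (dy k)))) s t =
        (Complex.exp (x (basisIndex s) * y (basisIndex t)) -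
          ∑ k, (w k : ℂ) * (dx k (basisIndex s) * dy k (basisIndex t))) / 2 ^ n := by
      rw [Matrix.sub_apply, Matrix.sum_apply, sub_div, Finset.sum_div]
      congr 1
      refine Finset.sum_congr rfl fun k _ => ?_
      rw [Matrix.smul_apply, diagOp_uniformProjection_diagOp_apply, smul_eq_mul]
      ring
    rw [hentry, norm_div, norm_pow, Complex.norm_ofNat]
    gcongr
    exact hd _ _
  -- The tolerance ε / (6α) is chosen so that total weight at most α times 3δ is ε/2.
  have hsecond : ‖∑ k, (w k : ℂ) • (diagOp (dx k) * (uniformProjection n * diagOp (dy k)) -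
      zeroBlock (UX k) * (uniformProjection n * zeroBlock (UY k)))‖ ≤ ε / 2 := by
    calc _ ≤ ∑ k, w k * (3 * δ) := by
          refine (norm_sum_le _ _).trans (Finset.sum_le_sum fun k _ => ?_)
          rw [norm_smul, Complex.norm_real, Real.norm_of_nonneg (hw k)]
          exact mul_le_mul_of_nonneg_left (hterm k) (hw k)
      _ = (∑ k, w k) * (3 * δ) := by rw [Finset.sum_mul]
      _ ≤ α * (3 * δ) := by gcongr
      _ = ε / 2 := by
          rw [hδ]
          field_simp
          norm_num
  rw [hsplit]
  calc _ ≤ _ := norm_add_le _ _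
    _ ≤ ε / 2 + ε / 2 := add_le_add hfirst hsecond
    _ = ε := add_halves ε

end Norms

/-! ### The Jacobi–Anger expansion -/

section Bessel

/-- The bound `(r ^ k / k!) e ^ r (r ^ m / m!)` for the terms of the Bessel series. -/
theorem bessel_term_le {r : ℝ} (hr : 0 ≤ r) (k m : ℕ) :
    r ^ (2 * m + k) / ((m.factorial : ℝ) * ((m + k).factorial : ℝ)) ≤
      r ^ k / k.factorial * Real.exp r * (r ^ m / m.factorial) := by
  have h1 : (m.factorial : ℝ) * k.factorial ≤ (m + k).factorial := by
    exact_mod_cast Nat.le_of_dvd (Nat.factorial_pos _)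
      (Nat.factorial_mul_factorial_dvd_factorial_add m k)
  have h2 : r ^ m / m.factorial ≤ Real.exp r := Real.pow_div_factorial_le_exp r hr m
  have hm : (0 : ℝ) < m.factorial := by positivity
  have hk : (0 : ℝ) < k.factorial := by positivity
  calc r ^ (2 * m + k) / ((m.factorial : ℝ) * ((m + k).factorial : ℝ))
      ≤ r ^ (2 * m + k) / ((m.factorial : ℝ) * (m.factorial * k.factorial)) := by gcongr
    _ = r ^ k / k.factorial * (r ^ m / m.factorial) * (r ^ m / m.factorial) := by
        field_simp
        ring
    _ ≤ _ := by gcongr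

theorem norm_bessel_term (z : ℂ) (k m : ℕ) :
    ‖(z / 2) ^ (2 * m + k) / ((m.factorial : ℂ) * ((m + k).factorial : ℂ))‖ =
      (‖z‖ / 2) ^ (2 * m + k) / ((m.factorial : ℝ) * ((m + k).factorial : ℝ)) := by
  simp

theorem hasSum_pow_div_factorial (r : ℝ) :
    HasSum (fun m : ℕ => r ^ m / m.factorial) (Real.exp r) := by
  rw [Real.exp_eq_exp_ℝ]
  exact NormedSpace.expSeries_div_hasSum_exp r

theorem summable_bessel_real {r : ℝ} (hr : 0 ≤ r) (k : ℕ) :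
    Summable fun m : ℕ => r ^ (2 * m + k) / ((m.factorial : ℝ) * ((m + k).factorial : ℝ)) :=
  Summable.of_nonneg_of_le (fun m => by positivity) (bessel_term_le hr k)
    ((hasSum_pow_div_factorial r).summable.mul_left _)

theorem hasSum_besselI (k : ℕ) (z : ℂ) :
    HasSum (fun m : ℕ => (z / 2) ^ (2 * m + k) / ((m.factorial : ℂ) * ((m + k).factorial : ℂ)))
      (besselI k z) :=
  (Summable.of_norm (by
    simp only [norm_bessel_term]
    exact summable_bessel_real (by positivity) k)).hasSum

/-- The Bessel function of a nonnegative real number. -/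
theorem exists_besselI_ofReal (k : ℕ) {r : ℝ} (hr : 0 ≤ r) :
    ∃ b : ℝ, 0 ≤ b ∧ besselI k r = b ∧ b ≤ (r / 2) ^ k / k.factorial * Real.exp r ∧
      ∀ z : ℂ, ‖z‖ ≤ r → ‖besselI k z‖ ≤ b := by
  have hs := (summable_bessel_real (r := r / 2) (by positivity) k).hasSum
  refine ⟨_, hs.nonneg fun m => by positivity, ?_, ?_, fun z hz => ?_⟩
  · refine (hasSum_besselI k r).unique ?_
    convert Complex.hasSum_ofReal.mpr hs using 2
    push_cast
    rfl
  · refine (hasSum_le (bessel_term_le (by positivity) k) hs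
      ((hasSum_pow_div_factorial _).mul_left _)).trans ?_
    rw [mul_assoc, ← Real.exp_add, add_halves]
  · refine (hasSum_besselI k z).norm_le_of_bounded hs fun m => ?_
    rw [norm_bessel_term]
    gcongr

/-- Pairs of natural numbers, split according to which entry is the larger one. -/
def natProdSplit : (ℕ × ℕ) ⊕ (ℕ × ℕ) ≃ ℕ × ℕ where
  toFun := Sum.elim (fun p => (p.2 + p.1, p.2)) fun p => (p.2, p.2 + p.1 + 1)
  invFun q := if q.2 ≤ q.1 then Sum.inl (q.1 - q.2, q.2) else Sum.inr (q.2 - q.1 - 1, q.1)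
  left_inv := by
    rintro (⟨k, m⟩ | ⟨k, m⟩)
    · simp
    · have : ¬ m + k + 1 ≤ m := by omega
      simp only [Sum.elim_inr, this, if_false, Sum.inr.injEq, Prod.mk.injEq, and_true]
      omega
  right_inv := by
    rintro ⟨p, q⟩
    by_cases h : q ≤ p
    · simp only [h, if_true, Sum.elim_inl, Prod.mk.injEq, and_true]
      omega
    · simp only [h, if_false, Sum.elim_inr, Prod.mk.injEq, true_and]
      omega

/-- With u = e^{𝐢θ} and v = u⁻¹, e^{w cos θ} = e^{wu/2} e^{wv/2}. Grouping the terms (p, q) of the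
product of the two exponential series by p - q gives u^k I_k(w) for p - q = k ≥ 0 and v^k I_k(w) for
q - p = k ≥ 1, and u^k + v^k = 2 cos kθ. -/
theorem hasSum_jacobiAnger_cos (w : ℂ) (θ : ℝ) :
    HasSum (fun k : ℕ => chebWeight k * besselI k w * (Real.cos (k * θ) : ℂ))
      (Complex.exp (w * Real.cos θ)) := by
  set u : ℂ := Complex.exp (θ * Complex.I) with hu
  set v : ℂ := Complex.exp (-(θ * Complex.I)) with hv
  have huv : u * v = 1 := by rw [hu, hv, ← Complex.exp_add]; simp
  have hexp : Complex.exp (w * Real.cos θ) =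
      Complex.exp (w / 2 * u) * Complex.exp (w / 2 * v) := by
    rw [← Complex.exp_add, Complex.ofReal_cos, Complex.cos, hu, hv, neg_mul]
    congr 1
    ring
  have hcos : ∀ k : ℕ, 2 * (Real.cos (k * θ) : ℂ) = u ^ k + v ^ k := by
    intro k
    rw [hu, hv, ← Complex.exp_nat_mul, ← Complex.exp_nat_mul, Complex.ofReal_cos,
      Complex.two_cos]
    push_cast
    congr 2 <;> ring
  have hE : ∀ z : ℂ, HasSum (fun m : ℕ => z ^ m / m.factorial) (Complex.exp z) := fun z => by
    rw [Complex.exp_eq_exp_ℂ]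
    exact NormedSpace.expSeries_div_hasSum_exp z
  have hEn : ∀ z : ℂ, Summable fun m : ℕ => ‖z ^ m / m.factorial‖ :=
    NormedSpace.norm_expSeries_div_summable
  have hmul : ∀ (F G : ℕ → ℂ) (a b : ℂ), HasSum F a → HasSum G b →
      (Summable fun m => ‖F m‖) → (Summable fun m => ‖G m‖) →
      HasSum (fun p : ℕ × ℕ => F p.1 * G p.2) (a * b) := fun F G a b hF hG hF' hG' =>
    hF.mul hG (summable_mul_of_summable_norm hF' hG')
  obtain ⟨f, hf, hprod⟩ : ∃ f : ℕ × ℕ → ℂ, (∀ p q, f (p, q) =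
      (w / 2 * u) ^ p / p.factorial * ((w / 2 * v) ^ q / q.factorial)) ∧
      HasSum f (Complex.exp (w * Real.cos θ)) := by
    rw [hexp]
    exact ⟨_, fun _ _ => rfl, hmul _ _ _ _ (hE (w / 2 * u)) (hE (w / 2 * v))
      (hEn (w / 2 * u)) (hEn (w / 2 * v))⟩
  rw [← natProdSplit.hasSum_iff] at hprod
  have hl := (hprod.summable.comp_injective Sum.inl_injective).hasSum
  have hr := (hprod.summable.comp_injective Sum.inr_injective).hasSum
  have htot := hprod.unique (hl.sum hr)
  generalize (∑' p, ((f ∘ natProdSplit) ∘ Sum.inl) p) = a at hl htot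
  generalize (∑' p, ((f ∘ natProdSplit) ∘ Sum.inr) p) = b at hr htot
  have hl0 : HasSum (fun p : ℕ × ℕ => f (p.2 + p.1, p.2)) a := hl
  have hr0 : HasSum (fun p : ℕ × ℕ => f (p.2, p.2 + p.1 + 1)) b := hr
  have hl1 : HasSum (fun k : ℕ => u ^ k * besselI k w) a := hl0.prod_fiberwise fun k => by
    refine ((hasSum_besselI k w).mul_left (u ^ k)).congr_fun fun m => ?_
    have huvm : u ^ m * v ^ m = 1 := by rw [← mul_pow, huv, one_pow]
    rw [hf]
    calc _ = (w / 2) ^ (2 * m + k) * u ^ k * (u ^ m * v ^ m) /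
          ((m + k).factorial * m.factorial) := by
          rw [div_mul_div_comm]
          congr 1
          ring
      _ = _ := by rw [huvm]; ring
  have hr1 : HasSum (fun k : ℕ => v ^ (k + 1) * besselI (k + 1) w) b :=
    hr0.prod_fiberwise fun k => by
    refine ((hasSum_besselI (k + 1) w).mul_left (v ^ (k + 1))).congr_fun fun m => ?_
    have huvm : u ^ m * v ^ m = 1 := by rw [← mul_pow, huv, one_pow]
    rw [hf]
    calc _ = (w / 2) ^ (2 * m + (k + 1)) * v ^ (k + 1) * (u ^ m * v ^ m) /
          (m.factorial * (m + (k + 1)).factorial) := by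
          rw [div_mul_div_comm, add_assoc m k 1]
          congr 1
          ring
      _ = _ := by rw [huvm]; ring
  -- The order 0 occurs only in the first series; padding the second with a zero there allows
  -- termwise addition and produces the weight 2 - δ_k.
  have hr2 : HasSum (fun k : ℕ => if k = 0 then 0 else v ^ k * besselI k w) b := by
    have h := (hasSum_nat_add_iff (f := fun k : ℕ => if k = 0 then 0 else v ^ k * besselI k w)
      1).mp (by simpa using hr1)
    simpa using h
  rw [htot]
  refine (hl1.add hr2).congr_fun fun k => ?_
  by_cases hk : k = 0
  · subst hk
    simp [chebWeight]
  · simp only [chebWeight, hk, if_false]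
    linear_combination besselI k w * hcos k

/-- The truncation error of the Jacobi–Anger expansion, and a bound for its partial sums. -/
theorem jacobiAnger_truncation {w : ℂ} {z t : ℝ} (hw : ‖w‖ ≤ z) (ht : |t| ≤ 1) (K : ℕ) :
    ‖Complex.exp (w * t) -
        ∑ k ∈ Finset.range (K + 1), chebWeight k * besselI k w * (chebT k t : ℂ)‖ ≤
      2 * Real.exp (3 / 2 * z) * ((z / 2) ^ (K + 1) / (K + 1).factorial) ∧
    ‖∑ k ∈ Finset.range (K + 1), chebWeight k * besselI k w * (chebT k t : ℂ)‖ ≤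
      Real.exp z := by
  have hz : 0 ≤ z := (norm_nonneg _).trans hw
  have hchebT : ∀ k, |chebT k t| ≤ 1 := fun k =>
    Polynomial.Chebyshev.abs_eval_T_real_le_one k ht
  have hweight : ∀ k, ‖chebWeight k‖ ≤ 2 := fun k => by
    unfold chebWeight
    split_ifs <;> norm_num
  choose b hb0 hbI hbz hbw using fun k => exists_besselI_ofReal k hz
  have hterm : ∀ k, ‖chebWeight k * besselI k w * (chebT k t : ℂ)‖ ≤ ‖chebWeight k‖ * b k := by
    intro k
    rw [norm_mul, norm_mul, Complex.norm_real, Real.norm_eq_abs]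
    calc _ ≤ ‖chebWeight k‖ * b k * 1 := by
          gcongr
          · exact mul_nonneg (norm_nonneg _) (hb0 k)
          · exact hbw k w hw
          · exact hchebT k
      _ = _ := mul_one _
  constructor
  · have hsum : HasSum (fun k : ℕ => chebWeight k * besselI k w * (chebT k t : ℂ))
        (Complex.exp (w * t)) := by
      have hcos : Real.cos (Real.arccos t) = t :=
        Real.cos_arccos (abs_le.mp ht).1 (abs_le.mp ht).2
      have h := hasSum_jacobiAnger_cos w (Real.arccos t)
      rw [hcos] at h
      refine h.congr_fun fun k => ?_
      congr 2
      rw [chebT, ← hcos, Polynomial.Chebyshev.T_real_cos, hcos]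
      simp
    -- The tail is dominated by Σ 2 e^z (z/2)^{K+1+k}/(K+1+k)!. From (K+1)! k! ≤ (K+1+k)! the first
    -- omitted term factors out and the rest sums to e^{z/2}.
    have htail := (hasSum_nat_add_iff' (K + 1)).mpr hsum
    refine htail.norm_le_of_bounded (g := fun k : ℕ => 2 * Real.exp z *
      ((z / 2) ^ (K + 1) / (K + 1).factorial) * ((z / 2) ^ k / k.factorial)) ?_ fun k => ?_
    · have h := (hasSum_pow_div_factorial (z / 2)).mul_left
        (2 * Real.exp z * ((z / 2) ^ (K + 1) / (K + 1).factorial))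
      have he : 2 * Real.exp (3 / 2 * z) * ((z / 2) ^ (K + 1) / (K + 1).factorial) =
          2 * Real.exp z * ((z / 2) ^ (K + 1) / (K + 1).factorial) * Real.exp (z / 2) := by
        rw [show 3 / 2 * z = z + z / 2 by ring, Real.exp_add]
        ring
      rwa [he]
    · have hfac : ((K + 1).factorial : ℝ) * k.factorial ≤ (k + (K + 1)).factorial := by
        rw [add_comm k]
        exact_mod_cast Nat.le_of_dvd (Nat.factorial_pos _)
          (Nat.factorial_mul_factorial_dvd_factorial_add (K + 1) k)
      calc _ ≤ ‖chebWeight (k + (K + 1))‖ * b (k + (K + 1)) := hterm _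
        _ ≤ 2 * ((z / 2) ^ (k + (K + 1)) / (k + (K + 1)).factorial * Real.exp z) := by
            gcongr
            · exact hb0 _
            · exact hweight _
            · exact hbz _
        _ ≤ 2 * ((z / 2) ^ (k + (K + 1)) / ((K + 1).factorial * k.factorial) * Real.exp z) := by
            gcongr
        _ = _ := by
            rw [pow_add]
            field_simp
  -- The expansion at the real point z and θ = 0 has nonnegative terms that majorise those at w, and
  -- its sum is e^z.
  · have hsum : HasSum (fun k : ℕ => ‖chebWeight k‖ * b k) (Real.exp z) := by
      rw [← Complex.hasSum_ofReal]
      have h := hasSum_jacobiAnger_cos (z : ℂ) 0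
      simp only [mul_zero, Real.cos_zero, Complex.ofReal_one, mul_one, ← Complex.ofReal_exp] at h
      refine h.congr_fun fun k => ?_
      rw [hbI, Complex.ofReal_mul]
      congr 1
      unfold chebWeight
      split_ifs <;> simp
    refine (norm_sum_le _ _).trans ((Finset.sum_le_sum fun k _ => hterm k).trans ?_)
    exact sum_le_hasSum _ (fun k _ => mul_nonneg (norm_nonneg _) (hb0 k)) hsum

end Bessel

/-! ### The double Chebyshev expansion of the kernel -/

section DoubleChebyshev

variable {N : ℕ} (x y : Fin N → ℂ)

theorem norm_le_maxAbs (i : Fin N) : ‖x i‖ ≤ maxAbs x :=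
  le_ciSup (f := fun i => ‖x i‖) (Set.finite_range _).bddAbove i

theorem abs_re_le_maxRe (i : Fin N) : |(y i).re| ≤ maxRe y :=
  le_ciSup (f := fun i => |(y i).re|) (Set.finite_range _).bddAbove i

theorem abs_im_le_maxIm (i : Fin N) : |(y i).im| ≤ maxIm y :=
  le_ciSup (f := fun i => |(y i).im|) (Set.finite_range _).bddAbove i

theorem maxAbs_nonneg : 0 ≤ maxAbs x := Real.iSup_nonneg fun _ => norm_nonneg _

theorem maxRe_nonneg : 0 ≤ maxRe y := Real.iSup_nonneg fun _ => abs_nonneg _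

theorem maxIm_nonneg : 0 ≤ maxIm y := Real.iSup_nonneg fun _ => abs_nonneg _

theorem maxRe_le_maxAbs : maxRe y ≤ maxAbs y :=
  Real.iSup_le (fun j => (Complex.abs_re_le_norm _).trans (norm_le_maxAbs y j)) (maxAbs_nonneg y)

theorem maxIm_le_maxAbs : maxIm y ≤ maxAbs y :=
  Real.iSup_le (fun j => (Complex.abs_im_le_norm _).trans (norm_le_maxAbs y j)) (maxAbs_nonneg y)

theorem norm_xRe_le (i : Fin N) : ‖xRe x y i‖ ≤ maxAbs x * maxAbs y := by
  rw [xRe, norm_mul, Complex.norm_real, Real.norm_of_nonneg (maxRe_nonneg y)]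
  exact mul_le_mul (norm_le_maxAbs x i) (maxRe_le_maxAbs y) (maxRe_nonneg y) (maxAbs_nonneg x)

theorem norm_xIm_le (i : Fin N) : ‖xIm x y i‖ ≤ maxAbs x * maxAbs y := by
  rw [xIm, norm_mul, norm_mul, Complex.norm_I, one_mul, Complex.norm_real,
    Real.norm_of_nonneg (maxIm_nonneg y)]
  exact mul_le_mul (norm_le_maxAbs x i) (maxIm_le_maxAbs y) (maxIm_nonneg y) (maxAbs_nonneg x)

theorem abs_yRe_le_one (j : Fin N) : |yRe y j| ≤ 1 := by
  rw [yRe, abs_div, abs_of_nonneg (maxRe_nonneg y)]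
  exact div_le_one_of_le₀ (abs_re_le_maxRe y j) (maxRe_nonneg y)

theorem abs_yIm_le_one (j : Fin N) : |yIm y j| ≤ 1 := by
  rw [yIm, abs_div, abs_of_nonneg (maxIm_nonneg y)]
  exact div_le_one_of_le₀ (abs_im_le_maxIm y j) (maxIm_nonneg y)

theorem xRe_mul_yRe_add_xIm_mul_yIm (i j : Fin N) :
    xRe x y i * (yRe y j : ℂ) + xIm x y i * (yIm y j : ℂ) = x i * y j := by
  -- If the maximum is 0 then all real parts vanish, so the default value of 0/0 does no harm.
  have h1 : maxRe y * yRe y j = (y j).re :=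
    mul_div_cancel_of_imp' fun h => by
      have := abs_re_le_maxRe y j
      rw [h] at this
      exact abs_eq_zero.mp (le_antisymm this (abs_nonneg _))
  have h2 : maxIm y * yIm y j = (y j).im :=
    mul_div_cancel_of_imp' fun h => by
      have := abs_im_le_maxIm y j
      rw [h] at this
      exact abs_eq_zero.mp (le_antisymm this (abs_nonneg _))
  have h1' : (maxRe y : ℂ) * (yRe y j : ℂ) = ((y j).re : ℂ) := by exact_mod_cast h1
  have h2' : (maxIm y : ℂ) * (yIm y j : ℂ) = ((y j).im : ℂ) := by exact_mod_cast h2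
  conv_rhs => rw [← Complex.re_add_im (y j)]
  rw [xRe, xIm, ← h1', ← h2']
  ring

/-- The truncation error of the double Chebyshev expansion. -/
theorem norm_exp_sub_doubleChebSum_le (K : ℕ) (i j : Fin N) :
    ‖Complex.exp (x i * y j) - doubleChebSum x y K i j‖ ≤
      8 * Real.exp (5 / 2 * (maxAbs x * maxAbs y)) * (maxAbs x * maxAbs y / 2) ^ (K + 1)
        / ((K + 1).factorial : ℝ) := by
  obtain ⟨h1, h2⟩ := jacobiAnger_truncation (norm_xRe_le x y i) (abs_yRe_le_one y j) K
  obtain ⟨h1', -⟩ := jacobiAnger_truncation (norm_xIm_le x y i) (abs_yIm_le_one y j) K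
  set z := maxAbs x * maxAbs y with hz
  have hz0 : 0 ≤ z := mul_nonneg (maxAbs_nonneg x) (maxAbs_nonneg y)
  set S := ∑ k ∈ Finset.range (K + 1),
    chebWeight k * besselI k (xRe x y i) * (chebT k (yRe y j) : ℂ) with hS
  set S' := ∑ k ∈ Finset.range (K + 1),
    chebWeight k * besselI k (xIm x y i) * (chebT k (yIm y j) : ℂ) with hS'
  have hdouble : doubleChebSum x y K i j = S * S' := by
    rw [hS, hS', Finset.sum_mul_sum, doubleChebSum]
    exact Finset.sum_congr rfl fun k _ => Finset.sum_congr rfl fun k' _ => by ring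
  set E' := Complex.exp (xIm x y i * (yIm y j : ℂ)) with hE'
  have hE'le : ‖E'‖ ≤ Real.exp z := by
    rw [hE', Complex.norm_exp]
    gcongr
    calc _ ≤ ‖xIm x y i * (yIm y j : ℂ)‖ := Complex.re_le_norm _
      _ ≤ z * 1 := by
          rw [norm_mul, Complex.norm_real, Real.norm_eq_abs]
          exact mul_le_mul (norm_xIm_le x y i) (abs_yIm_le_one y j) (abs_nonneg _) hz0
      _ = z := mul_one z
  rw [← xRe_mul_yRe_add_xIm_mul_yIm x y i j, Complex.exp_add, hdouble]
  -- Both `E'` and the partial sum `S` are at most e^z in modulus, so each difference costs e^z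
  -- times the single truncation error; this yields the constant 4.
  have hsplit : Complex.exp (xRe x y i * (yRe y j : ℂ)) * E' - S * S' =
      (Complex.exp (xRe x y i * (yRe y j : ℂ)) - S) * E' + S * (E' - S') := by ring
  rw [hsplit]
  set τ := 2 * Real.exp (3 / 2 * z) * ((z / 2) ^ (K + 1) / (K + 1).factorial) with hτ
  calc _ ≤ τ * Real.exp z + Real.exp z * τ := by
        refine (norm_add_le _ _).trans ?_
        rw [norm_mul, norm_mul]
        gcongr
    _ = 4 * (Real.exp (5 / 2 * z) * ((z / 2) ^ (K + 1) / (K + 1).factorial)) := by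
        rw [hτ, show 5 / 2 * z = 3 / 2 * z + z by ring, Real.exp_add]
        ring
    _ ≤ 8 * (Real.exp (5 / 2 * z) * ((z / 2) ^ (K + 1) / (K + 1).factorial)) := by
        gcongr
        norm_num
    _ = _ := by ring

end DoubleChebyshev

/-! ### Truncation orders and costs -/

theorem log_le_two_mul_sqrt {u : ℝ} (hu : 0 < u) : Real.log u ≤ 2 * √u := by
  have h := Real.log_le_sub_one_of_pos (Real.sqrt_pos.mpr hu)
  rw [Real.log_sqrt hu.le] at h
  linarith

/-- A truncation order of at least `4 e ^ 4` times the scale makes the remainders smaller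
than `ε`. -/
theorem truncation_error_le {z ε : ℝ} {K : ℕ} (hz : 0 < z) (hε : 0 < ε) (hε1 : ε < 1)
    (hK : 1 ≤ K) (h : 4 * Real.exp 4 * truncationScale z ε ≤ K) :
    16 * Real.exp (3 * z) * (z ^ (K + 1) / (K + 1).factorial) ≤ ε := by
  set l := Real.log (1 / ε) with hl
  have hl0 : 0 < l := Real.log_pos (by rw [lt_div_iff₀ hε]; linarith)
  have hεl : Real.exp (-l) = ε := by
    rw [hl, one_div, Real.log_inv, neg_neg, Real.exp_log hε]
  set u := Real.exp 1 + l / z with hu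
  set D := Real.log u with hD
  have hr0 : 0 < l / z := by positivity
  have he1 : 1 < Real.exp 1 := by simp
  have hu0 : 0 < u := by positivity
  have hD1 : 1 ≤ D := by
    rw [hD, Real.le_log_iff_exp_le hu0]
    linarith
  set s := √u with hs
  have hs2 : s * s = u := Real.mul_self_sqrt hu0.le
  have hs1 : 1 ≤ s := by
    rw [hs, Real.one_le_sqrt]
    linarith
  have hDs : D ≤ 2 * s := log_le_two_mul_sqrt hu0
  have hsexp : Real.exp (D / 2) = s := by
    rw [hD, ← Real.log_sqrt hu0.le, Real.exp_log (by linarith)]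
  have hscale : truncationScale z ε = z + l / D := rfl
  rw [hscale] at h
  set m := K + 1 with hm
  have hmK : (m : ℝ) = K + 1 := by rw [hm]; push_cast; rfl
  have hK1 : (1 : ℝ) ≤ K := by exact_mod_cast hK
  have hm0 : (0 : ℝ) < m := by linarith
  have he4 : 1 ≤ Real.exp 4 := Real.one_le_exp (by norm_num)
  have hlD : 0 < l / D := by positivity
  have hmz : 2 * z ≤ m := by nlinarith
  have hml : l ≤ m * (D / 2) := by
    have h1 : 2 * (l / D) ≤ m := by nlinarith
    calc l = 2 * (l / D) * (D / 2) := by field_simp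
      _ ≤ m * (D / 2) := by gcongr
  -- the ratio of `z` and the truncation order
  have hratio : z * Real.exp 1 * Real.exp (3 + D / 2) ≤ m := by
    -- Here s = √u = e/s + (l/z)/s. The first summand is at most e < 3, and D = ln u ≤ 2s bounds the
    -- second by 2 (l/z)/D. Multiplying by e⁴ z gives the constant 4e⁴ in front of the scale z +
    -- l/D.
    have h2 : s ≤ 4 * (1 + l / z / D) := by
      have h3 : l / z / (2 * s) ≤ l / z / D := by gcongr
      have h4 : s = Real.exp 1 / s + l / z / s := by
        rw [← add_div, ← hu, ← hs2]
        field_simp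
      have h5 : Real.exp 1 / s ≤ 3 :=
        (div_le_self (by positivity) hs1).trans (by linarith [Real.exp_one_lt_d9])
      have h6 : l / z / (2 * s) = l / z / s / 2 := by field_simp
      have h7 : 0 < l / z / s := by positivity
      rw [h6] at h3
      linarith
    calc z * Real.exp 1 * Real.exp (3 + D / 2) = Real.exp 4 * (z * s) := by
          rw [Real.exp_add, hsexp, show (4 : ℝ) = 1 + 3 by norm_num, Real.exp_add]
          ring
      _ ≤ Real.exp 4 * (z * (4 * (1 + l / z / D))) := by gcongr
      _ = 4 * Real.exp 4 * (z + l / D) := by field_simp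
      _ ≤ m := by linarith
  have hq : z * Real.exp 1 / m ≤ Real.exp (-(3 + D / 2)) := by
    rw [div_le_iff₀ hm0, Real.exp_neg, ← div_eq_inv_mul, le_div_iff₀ (Real.exp_pos _)]
    exact hratio
  have hfac : z ^ m / m.factorial ≤ (z * Real.exp 1 / m) ^ m := by
    have h1 : (m : ℝ) ^ m / m.factorial ≤ Real.exp m :=
      Real.pow_div_factorial_le_exp _ hm0.le m
    calc z ^ m / m.factorial = (z / m) ^ m * ((m : ℝ) ^ m / m.factorial) := by
          rw [div_pow]
          field_simp
      _ ≤ (z / m) ^ m * Real.exp m := by gcongr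
      _ = (z * Real.exp 1 / m) ^ m := by
          rw [← Real.exp_one_pow, ← mul_pow]
          congr 1
          ring
  have h16 : (16 : ℝ) ≤ Real.exp 3 := by
    rw [show (3 : ℝ) = ((3 : ℕ) : ℝ) by norm_num, ← Real.exp_one_pow]
    have := Real.exp_one_gt_d9
    have h27 : (2.7 : ℝ) ≤ Real.exp 1 := by linarith
    calc (16 : ℝ) ≤ 2.7 ^ 3 := by norm_num
      _ ≤ _ := by gcongr
  calc 16 * Real.exp (3 * z) * (z ^ m / m.factorial)
      ≤ Real.exp 3 * Real.exp (3 * z) * Real.exp (-(3 + D / 2)) ^ m := by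
        gcongr
        exact hfac.trans (by gcongr)
    _ = Real.exp (3 + 3 * z - m * (3 + D / 2)) := by
        rw [← Real.exp_nat_mul, ← Real.exp_add, ← Real.exp_add]
        congr 1
        ring
    -- The term mD/2 absorbs l, while 3 + 3z ≤ 3m follows from 2z ≤ m and m ≥ 2, the latter because
    -- K ≥ 1.
    _ ≤ Real.exp (-l) := by
        gcongr
        nlinarith
    _ = ε := hεl

/-- A block-encoding of the quantum Laplace transform from an approximate expansion of its
kernel, with `κ` as index set, and its costs in terms of a truncation order `K`. -/
theorem exists_QLT_circuit {n a K L : ℕ} {κ : Type} [Fintype κ] [DecidableEq κ] (hn : 1 ≤ n)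
    (hK : 1 ≤ K) {B : ℝ} (hB : 1 ≤ B) (hκB : (Fintype.card κ : ℝ) ≤ 4 * B)
    (hκK : (Fintype.card κ : ℝ) ≤ 4 * (K : ℝ) ^ 2)
    (hL : L = ⌈Real.logb 2 (Fintype.card κ)⌉₊)
    (w : κ → ℝ) (hw : ∀ k, 0 ≤ w k) (hpos : 0 < ∑ k, w k) {α : ℝ} (hα : ∑ k, w k ≤ α)
    (hα1 : 1 ≤ α) {ε : ℝ} (hε : 0 < ε) (hε1 : ε < 1) (x y : Fin (2 ^ n) → ℂ)
    (dx dy : κ → Fin (2 ^ n) → ℂ)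
    (hd : ∀ i j, ‖Complex.exp (x i * y j) - ∑ k, (w k : ℂ) * (dx k i * dy k j)‖ ≤ ε / 2) :
    ∃ c : Circuit (Fin (2 * n + 2 * a + L) ⊕ Fin n) (Fin a ⊕ Fin n) (κ ⊕ κ),
      (c.queries : ℝ) ≤ 1000 * B ∧
      (c.size : ℝ) ≤ 1000 * (n * B) * (1 + Real.log K) ^ 2 ∧
      (c.depth : ℝ) ≤ 1000 * ((1 + Real.log n) * B) * (1 + Real.log K) ^ 2 ∧
      ∀ UX UY : κ → Op (Fin a ⊕ Fin n),
        (∀ k, IsBlockEncoding 1 (ε / (6 * α)) (UX k) (diagOp (dx k))) →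
        (∀ k, IsBlockEncoding 1 (ε / (6 * α)) (UY k) (diagOp (dy k))) →
        IsBlockEncoding α ε (Circuit.eval (Sum.elim UX UY) c) (QLT x y) := by
  have hne : Nonempty κ := by
    by_contra h
    rw [not_nonempty_iff] at h
    simp at hpos
  set M := Fintype.card κ with hM
  have hM1 : 1 ≤ M := Fintype.card_pos
  have hM1' : (1 : ℝ) ≤ M := by exact_mod_cast hM1
  have hlogb0 : 0 ≤ Real.logb 2 M := Real.logb_nonneg (by norm_num) hM1'
  have hML : (M : ℝ) ≤ 2 ^ L := by
    rw [← Real.rpow_natCast, ← Real.logb_le_iff_le_rpow (by norm_num) (by linarith), hL]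
    exact Nat.le_ceil _
  have hLlt : (L : ℝ) < Real.logb 2 M + 1 := hL ▸ Nat.ceil_lt_add_one hlogb0
  have hLM : (2 : ℝ) ^ L ≤ 2 * M := by
    rw [← Real.rpow_natCast]
    calc (2 : ℝ) ^ (L : ℝ) ≤ 2 ^ (Real.logb 2 M + 1) := by
          gcongr
          norm_num
      _ = 2 * M := by
          rw [Real.rpow_add (by norm_num), Real.rpow_logb (by norm_num) (by norm_num)
            (by linarith), Real.rpow_one, mul_comm]
  have hcard : M ≤ Fintype.card (Bits (Fin L)) := by
    have : (M : ℝ) ≤ ((2 ^ L : ℕ) : ℝ) := by push_cast; exact hML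
    simpa using (Nat.cast_le.mp this : M ≤ 2 ^ L)
  obtain ⟨pat⟩ := Function.Embedding.nonempty_of_card_le hcard
  -- The registers need n + 1 + 2a + L ancillas; the flag fits into 2n + 2a + L because n ≥ 1.
  obtain ⟨e⟩ := Function.Embedding.nonempty_of_card_le
    (α := Fin n ⊕ Unit ⊕ Fin a ⊕ Fin a ⊕ Fin L) (β := Fin (2 * n + 2 * a + L)) (by
      simp only [Fintype.card_sum, Fintype.card_fin, Fintype.card_unit]
      omega)
  have hK1 : (1 : ℝ) ≤ K := by exact_mod_cast hK
  have hn1 : (1 : ℝ) ≤ n := by exact_mod_cast hn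
  set Λ := 1 + Real.log K with hΛ
  have hΛ1 : 1 ≤ Λ := by linarith [Real.log_nonneg hK1]
  have hLΛ : (L : ℝ) ≤ 3 * Λ := by
    have hln2 : 0.69 ≤ Real.log 2 := by linarith [Real.log_two_gt_d9]
    have h1 : Real.log M ≤ 2 * Real.log 2 + 2 * Real.log K := by
      calc Real.log M ≤ Real.log (4 * (K : ℝ) ^ 2) := Real.log_le_log (by linarith) hκK
        _ = 2 * Real.log 2 + 2 * Real.log K := by
          rw [Real.log_mul (by norm_num) (by positivity), Real.log_pow,
            show (4 : ℝ) = 2 ^ 2 by norm_num, Real.log_pow]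
          push_cast
          ring
    have h2 : Real.logb 2 M ≤ 2 + 3 * Real.log K := by
      rw [Real.logb, div_le_iff₀ (by linarith)]
      nlinarith [Real.log_nonneg hK1]
    linarith
  -- A power of two between L and 2L ≤ 6Λ; its square bounds the cost of a controlled flip.
  obtain ⟨r, hr, hr'⟩ : ∃ r : ℕ, L ≤ 2 ^ r ∧ (4 : ℝ) ^ r ≤ 36 * Λ ^ 2 := by
    by_cases hL0 : L = 0
    · exact ⟨0, by simp [hL0], by rw [pow_zero]; nlinarith⟩
    · refine ⟨Nat.log 2 L + 1, (Nat.lt_pow_succ_log_self (by norm_num) L).le, ?_⟩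
      have h1 : 2 ^ (Nat.log 2 L + 1) ≤ 2 * L := by
        rw [pow_succ, mul_comm]
        exact Nat.mul_le_mul_left 2 (Nat.pow_log_le_self 2 hL0)
      have h2 : (2 : ℝ) ^ (Nat.log 2 L + 1) ≤ 6 * Λ := by
        have h3 : ((2 ^ (Nat.log 2 L + 1) : ℕ) : ℝ) ≤ ((2 * L : ℕ) : ℝ) := by exact_mod_cast h1
        push_cast at h3
        linarith
      calc (4 : ℝ) ^ (Nat.log 2 L + 1) = (2 ^ (Nat.log 2 L + 1)) ^ 2 := by
            rw [show (4 : ℝ) = 2 ^ 2 by norm_num, ← pow_mul, ← pow_mul, mul_comm]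
        _ ≤ (6 * Λ) ^ 2 := by gcongr
        _ = 36 * Λ ^ 2 := by ring
  obtain ⟨c, h1, h2, h3, h4⟩ :=
    exists_blockEncoding_QLT e pat hr w hw hpos hα hα1 hε hε1 x y dx dy hd
  have hΛ2 : 1 ≤ Λ ^ 2 := by nlinarith
  have hBΛ : B ≤ B * Λ ^ 2 := by nlinarith
  -- 48 from the preparations and 576 from the selections; the remaining gates fit into 1000.
  have hmain : 6 * (2 : ℝ) ^ L + 4 * (M * 4 ^ r) ≤ 624 * (B * Λ ^ 2) := by
    calc 6 * (2 : ℝ) ^ L + 4 * (M * 4 ^ r) ≤ 6 * (2 * M) + 4 * (M * (36 * Λ ^ 2)) := by gcongr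
      _ ≤ 6 * (2 * (4 * B)) + 4 * (4 * B * (36 * Λ ^ 2)) := by gcongr
      _ ≤ 624 * (B * Λ ^ 2) := by nlinarith
  refine ⟨c, ?_, ?_, ?_, h4⟩
  · have : (c.queries : ℝ) ≤ 2 * M := by exact_mod_cast h1
    linarith
  · have h5 : (c.size : ℝ) ≤ 6 * 2 ^ L + 4 * (M * 4 ^ r) + n + 1 := by exact_mod_cast h2
    have h6 : B * Λ ^ 2 ≤ n * (B * Λ ^ 2) := by nlinarith
    have h7 : (n : ℝ) ≤ n * (B * Λ ^ 2) := by nlinarith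
    have h8 : 1000 * (n * B) * Λ ^ 2 = 1000 * (n * (B * Λ ^ 2)) := by ring
    rw [h8]
    linarith
  · have h5 : (c.depth : ℝ) ≤ 6 * 2 ^ L + 4 * (M * 4 ^ r) + 2 := by exact_mod_cast h3
    have hlog : 0 ≤ Real.log n := Real.log_nonneg hn1
    have h6 : B * Λ ^ 2 ≤ (1 + Real.log n) * (B * Λ ^ 2) := by nlinarith
    have h8 : 1000 * ((1 + Real.log n) * B) * Λ ^ 2 =
      1000 * ((1 + Real.log n) * (B * Λ ^ 2)) := by ring
    rw [h8]
    linarith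

/-! ### The two expansions of the kernel -/

section Expansions

variable {N : ℕ} {x y : Fin N → ℂ}

theorem sum_range_pow_div_factorial_le {z : ℝ} (hz : 0 ≤ z) (K : ℕ) :
    ∑ k ∈ Finset.range K, z ^ k / k.factorial ≤ Real.exp z :=
  sum_le_hasSum _ (fun k _ => by positivity) (hasSum_pow_div_factorial z)

/-- The remainder of the Taylor expansion of `exp`. -/
theorem norm_exp_sub_sum_le {v : ℂ} {z : ℝ} (hv : ‖v‖ ≤ z) (K : ℕ) :
    ‖Complex.exp v - ∑ k ∈ Finset.range (K + 1), v ^ k / k.factorial‖ ≤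
      Real.exp z * (z ^ (K + 1) / (K + 1).factorial) := by
  have hz : 0 ≤ z := (norm_nonneg _).trans hv
  have hE : HasSum (fun m : ℕ => v ^ m / m.factorial) (Complex.exp v) := by
    rw [Complex.exp_eq_exp_ℂ]
    exact NormedSpace.expSeries_div_hasSum_exp v
  have h := (hasSum_pow_div_factorial z).mul_left (z ^ (K + 1) / (K + 1).factorial)
  rw [mul_comm] at h
  refine ((hasSum_nat_add_iff' (K + 1)).mpr hE).norm_le_of_bounded h fun k => ?_
  have hfac : ((K + 1).factorial : ℝ) * k.factorial ≤ (k + (K + 1)).factorial := by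
    rw [add_comm k]
    exact_mod_cast Nat.le_of_dvd (Nat.factorial_pos _)
      (Nat.factorial_mul_factorial_dvd_factorial_add (K + 1) k)
  rw [norm_div, norm_pow, Complex.norm_natCast]
  calc _ ≤ z ^ (k + (K + 1)) / ((K + 1).factorial * k.factorial) := by gcongr
    _ = _ := by
        rw [pow_add]
        field_simp

theorem norm_mul_le_maxAbs_mul (i j : Fin N) : ‖x i * y j‖ ≤ maxAbs x * maxAbs y := by
  rw [norm_mul]
  exact mul_le_mul (norm_le_maxAbs x i) (norm_le_maxAbs y j) (norm_nonneg _) (maxAbs_nonneg x)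

theorem norm_exp_sub_taylor_le (hx : 0 < maxAbs x) (hy : 0 < maxAbs y) (K : ℕ) (i j : Fin N) :
    ‖Complex.exp (x i * y j) - ∑ k : Fin (K + 1),
        (((maxAbs x * maxAbs y) ^ (k : ℕ) / (k : ℕ).factorial : ℝ) : ℂ) *
          ((x i / (maxAbs x : ℂ)) ^ (k : ℕ) * (y j / (maxAbs y : ℂ)) ^ (k : ℕ))‖ ≤
      Real.exp (maxAbs x * maxAbs y) *
        ((maxAbs x * maxAbs y) ^ (K + 1) / (K + 1).factorial) := by
  refine le_of_eq_of_le ?_ (norm_exp_sub_sum_le (norm_mul_le_maxAbs_mul i j) K)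
  rw [Finset.sum_range]
  congr 2
  refine Finset.sum_congr rfl fun k _ => ?_
  have hx' : (maxAbs x : ℂ) ≠ 0 := by exact_mod_cast hx.ne'
  have hy' : (maxAbs y : ℂ) ≠ 0 := by exact_mod_cast hy.ne'
  push_cast
  rw [← mul_pow, div_mul_div_comm, div_pow]
  field_simp

/-- The weights of the double Chebyshev expansion. -/
noncomputable def chebCoeff (x y : Fin N → ℂ) (k : ℕ) : ℝ :=
  (if k = 0 then 1 else 2) * besselMax x y k

theorem besselMax_pos (hx : 0 < maxAbs x) (hy : 0 < maxAbs y) (k : ℕ) : 0 < besselMax x y k := by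
  unfold besselMax
  positivity

theorem chebCoeff_pos (hx : 0 < maxAbs x) (hy : 0 < maxAbs y) (k : ℕ) : 0 < chebCoeff x y k :=
  mul_pos (by split_ifs <;> norm_num) (besselMax_pos hx hy k)

/-- The weights are e^z times 2 (z/2)^k/k!, halved at k = 0. The square of this bound is
`chebAlpha`, the sum over pairs of orders being a product. -/
theorem sum_chebCoeff_le (x y : Fin N → ℂ) (K : ℕ) :
    ∑ k ∈ Finset.range (K + 1), chebCoeff x y k ≤
      Real.exp (maxAbs x * maxAbs y) * (2 * Real.exp (maxAbs x * maxAbs y / 2) - 1) := by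
  set z := maxAbs x * maxAbs y with hz
  have hz0 : 0 ≤ z := mul_nonneg (maxAbs_nonneg x) (maxAbs_nonneg y)
  have hterm : ∀ k, chebCoeff x y k =
      Real.exp z * (2 * ((z / 2) ^ k / k.factorial) - if k = 0 then 1 else 0) := by
    intro k
    rw [chebCoeff, besselMax, ← hz]
    by_cases hk : k = 0
    · subst hk
      simp
      norm_num
    · simp only [hk, if_false]
      ring
  simp only [hterm]
  rw [← Finset.mul_sum, Finset.sum_sub_distrib, ← Finset.mul_sum, Finset.sum_ite_eq',
    if_pos (by simp)]
  gcongr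
  exact sum_range_pow_div_factorial_le (by positivity) _

theorem doubleChebSum_eq (hx : 0 < maxAbs x) (hy : 0 < maxAbs y) (K : ℕ) (i j : Fin N) :
    doubleChebSum x y K i j = ∑ k : Fin (K + 1) × Fin (K + 1),
      ((chebCoeff x y k.1 * chebCoeff x y k.2 : ℝ) : ℂ) *
        (besselI k.1 (xRe x y i) * besselI k.2 (xIm x y i) /
            ((besselMax x y k.1 : ℂ) * (besselMax x y k.2 : ℂ)) *
          ((chebT k.1 (yRe y j) : ℂ) * (chebT k.2 (yIm y j) : ℂ))) := by
  rw [doubleChebSum, Fintype.sum_prod_type, Finset.sum_range]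
  refine Finset.sum_congr rfl fun k _ => ?_
  rw [Finset.sum_range]
  refine Finset.sum_congr rfl fun k' _ => ?_
  have hb : ∀ k, (besselMax x y k : ℂ) ≠ 0 := fun k => by
    exact_mod_cast (besselMax_pos hx hy k).ne'
  have hc : ∀ k, (chebCoeff x y k : ℂ) = chebWeight k * besselMax x y k := fun k => by
    rw [chebCoeff, chebWeight]
    split_ifs <;> push_cast <;> rfl
  rw [Complex.ofReal_mul, hc, hc]
  have h1 := hb k
  have h2 := hb k'
  field_simp

end Expansions

/-! ### Assembly of the two block-encodings -/

theorem mainTheorem2 :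
    -- Block-encodings: the constants are absolute; the truncation order is any integer `K ≥ 1`
    -- that is at least `c` times the scale.
    (∃ c C : ℝ, ∃ p : ℕ, 0 < c ∧ 0 < C ∧
      ∀ (n a K : ℕ) (x y : Fin (2 ^ n) → ℂ) (ε : ℝ),
        1 ≤ n → 1 ≤ K → 0 < maxAbs x → 0 < maxAbs y → 0 < ε → ε < 1 →
        c * truncationScale (maxAbs x * maxAbs y) ε ≤ (K : ℝ) →
        -- Taylor expansion
        (∃ circ : Circuit (Fin (2 * n + 2 * a + ⌈Real.logb 2 ((K : ℝ) + 1)⌉₊) ⊕ Fin n)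
            (Fin a ⊕ Fin n) (Fin (K + 1) ⊕ Fin (K + 1)),
          (circ.queries : ℝ) ≤ C * K ∧
          (circ.size : ℝ) ≤ C * (n * K) * (1 + Real.log K) ^ p ∧
          (circ.depth : ℝ) ≤ C * ((1 + Real.log n) * K) * (1 + Real.log K) ^ p ∧
          ∀ UX UY : Fin (K + 1) → Op (Fin a ⊕ Fin n),
            (∀ k, IsBlockEncoding 1 (ε / (6 * Real.exp (maxAbs x * maxAbs y)))
              (UX k) (powOp x k)) →
            (∀ k, IsBlockEncoding 1 (ε / (6 * Real.exp (maxAbs x * maxAbs y)))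
              (UY k) (powOp y k)) →
            IsBlockEncoding (Real.exp (maxAbs x * maxAbs y)) ε
              (circ.eval (Sum.elim UX UY)) (QLT x y)) ∧
        -- Chebyshev expansion
        (∃ circ : Circuit (Fin (2 * n + 2 * a + ⌈2 * Real.logb 2 ((K : ℝ) + 1)⌉₊) ⊕ Fin n)
            (Fin a ⊕ Fin n) ((Fin (K + 1) × Fin (K + 1)) ⊕ (Fin (K + 1) × Fin (K + 1))),
          (circ.queries : ℝ) ≤ C * (K : ℝ) ^ 2 ∧
          (circ.size : ℝ) ≤ C * (n * (K : ℝ) ^ 2) * (1 + Real.log K) ^ p ∧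
          (circ.depth : ℝ) ≤ C * ((1 + Real.log n) * (K : ℝ) ^ 2) * (1 + Real.log K) ^ p ∧
          ∀ UI UT : Fin (K + 1) × Fin (K + 1) → Op (Fin a ⊕ Fin n),
            (∀ k, IsBlockEncoding 1 (ε / (6 * chebAlpha x y))
              (UI k) (besselOp x y k.1 k.2)) →
            (∀ k, IsBlockEncoding 1 (ε / (6 * chebAlpha x y))
              (UT k) (chebOp y k.1 k.2)) →
            IsBlockEncoding (chebAlpha x y) ε
              (circ.eval (Sum.elim UI UT)) (QLT x y))) ∧
    -- Truncation error of the double Chebyshev expansion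
    (∀ (n K : ℕ) (x y : Fin (2 ^ n) → ℂ),
      maxAbs x * maxAbs y ≤ (K : ℝ) + 1 →
      ∀ i j, ‖Complex.exp (x i * y j) - doubleChebSum x y K i j‖ ≤
        8 * Real.exp (5 / 2 * (maxAbs x * maxAbs y)) * (maxAbs x * maxAbs y / 2) ^ (K + 1)
          / ((K + 1).factorial : ℝ)) := by
  refine ⟨⟨4 * Real.exp 4, 1000, 2, by positivity, by norm_num, ?_⟩,
    fun n K x y _ i j => norm_exp_sub_doubleChebSum_le x y K i j⟩
  intro n a K x y ε hn hK hx hy hε hε1 hscale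
  set z := maxAbs x * maxAbs y with hz
  have hz0 : 0 < z := mul_pos hx hy
  have htrunc := truncation_error_le hz0 hε hε1 hK hscale
  have hq0 : 0 ≤ z ^ (K + 1) / ((K + 1).factorial : ℝ) := by positivity
  have hK1 : (1 : ℝ) ≤ K := by exact_mod_cast hK
  constructor
  · have hcard : (Fintype.card (Fin (K + 1)) : ℝ) = K + 1 := by simp
    have hsum := sum_range_pow_div_factorial_le hz0.le (K + 1)
    rw [Finset.sum_range] at hsum
    refine exists_QLT_circuit (κ := Fin (K + 1)) hn hK hK1 (by rw [hcard]; linarith)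
      (by rw [hcard]; nlinarith) (by rw [hcard]) (fun k => z ^ (k : ℕ) / (k : ℕ).factorial)
      (fun k => by positivity)
      (Finset.sum_pos (fun k _ => by positivity) Finset.univ_nonempty) hsum
      (Real.one_le_exp hz0.le) hε hε1 x y
      (fun k i => (x i / (maxAbs x : ℂ)) ^ (k : ℕ)) (fun k j => (y j / (maxAbs y : ℂ)) ^ (k : ℕ))
      fun i j => (norm_exp_sub_taylor_le hx hy K i j).trans ?_
    have h1 : Real.exp z ≤ Real.exp (3 * z) := by
      gcongr
      linarith
    nlinarith [mul_le_mul_of_nonneg_right h1 hq0, mul_nonneg (Real.exp_pos z).le hq0]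
  · have hcard : (Fintype.card (Fin (K + 1) × Fin (K + 1)) : ℝ) = ((K : ℝ) + 1) ^ 2 := by
      simp [sq]
    have hsum : ∑ k : Fin (K + 1) × Fin (K + 1), chebCoeff x y k.1 * chebCoeff x y k.2 ≤
        chebAlpha x y := by
      have h := sum_chebCoeff_le x y K
      rw [Finset.sum_range] at h
      have h0 : 0 ≤ ∑ k : Fin (K + 1), chebCoeff x y k :=
        Finset.sum_nonneg fun k _ => (chebCoeff_pos hx hy k).le
      calc _ = (∑ k : Fin (K + 1), chebCoeff x y k) ^ 2 := by
            rw [Fintype.sum_prod_type, sq, Finset.sum_mul_sum]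
        _ ≤ _ := pow_le_pow_left₀ h0 h 2
        _ = chebAlpha x y := by
            rw [chebAlpha, mul_pow, ← Real.exp_nat_mul]
            push_cast
            rfl
    have hα1 : 1 ≤ chebAlpha x y := by
      have h1 : 1 ≤ Real.exp (2 * (maxAbs x * maxAbs y)) := Real.one_le_exp (by positivity)
      have h2 : 1 ≤ Real.exp (maxAbs x * maxAbs y / 2) := Real.one_le_exp (by positivity)
      exact one_le_mul_of_one_le_of_one_le h1 (one_le_pow₀ (by linarith))
    -- There are (K+1)² ≤ 4K² terms, hence B = K², and log₂ (K+1)² = 2 log₂ (K+1) matches the stated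
    -- number of index qubits.
    refine exists_QLT_circuit (κ := Fin (K + 1) × Fin (K + 1)) hn hK (one_le_pow₀ hK1)
      (by rw [hcard]; nlinarith) (by rw [hcard]; nlinarith)
      (by rw [hcard, Real.logb_pow]; norm_num)
      (fun k => chebCoeff x y k.1 * chebCoeff x y k.2)
      (fun k => (mul_pos (chebCoeff_pos hx hy _) (chebCoeff_pos hx hy _)).le)
      (Finset.sum_pos (fun k _ => mul_pos (chebCoeff_pos hx hy _) (chebCoeff_pos hx hy _))
        Finset.univ_nonempty) hsum hα1 hε hε1 x y
      (fun k i => besselI k.1 (xRe x y i) * besselI k.2 (xIm x y i) /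
        ((besselMax x y k.1 : ℂ) * (besselMax x y k.2 : ℂ)))
      (fun k j => (chebT k.1 (yRe y j) : ℂ) * (chebT k.2 (yIm y j) : ℂ)) fun i j => ?_
    rw [← doubleChebSum_eq hx hy]
    refine (norm_exp_sub_doubleChebSum_le x y K i j).trans ?_
    rw [← hz]
    calc 8 * Real.exp (5 / 2 * z) * (z / 2) ^ (K + 1) / ((K + 1).factorial : ℝ)
        ≤ 8 * Real.exp (3 * z) * z ^ (K + 1) / ((K + 1).factorial : ℝ) := by
          gcongr
          · norm_num
          · linarith
      _ = 8 * Real.exp (3 * z) * (z ^ (K + 1) / ((K + 1).factorial : ℝ)) := by ring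
      _ ≤ ε / 2 := by linarith
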